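/- Let $d\ge 1$, let $\Omega\subset\mathbb Z^d$ be an infinite connected set (connected with respect to nearest neighbours, $|n-m|=1$), and let $v:\Omega\to\mathbb R$ be an arbitrary function. Let $h_v^\Omega$ be the discrete Schrödinger operator with Dirichlet boundary conditions, $$(h_v^\Omega f)(n)=\sum_{m\in\Omega,\ |n-m|=1} f(m)+v(n)f(n),\qquad n\in\Omega,$$ which is self-adjoint on $\ell^2(\Omega)$ with domain $\{f\in\ell^2(\Omega): h_v^\Omega f\in\ell^2(\Omega)\}$. For $\phi\in\ell^2(\Omega)$ let $\mu^\phi$ be its spectral measure, i.e. the unique finite Borel measure on $\mathbb R$ with $\int f\,d\mu^\phi=(f(h_v^\Omega)\phi,\phi)$ for every bounded Borel function $f$. For a Borel measure $\mu$ on $\mathbb R$ put $$D^\alpha\mu(E)=\limsup_{\delta\downarrow 0}\frac{\mu((E-\delta,E+\delta))}{\delta^\alpha}\in[0,\infty],$$ and let $C_R=\{n\in\mathbb Z^d: |n_i|\le R \text{ for all } i\}$. **Theorem 3.1.** Let $E\in\mathbb R$ and let $u=u(\cdot,E):\Omega\to\mathbb C$ (not necessarily in $\ell^2(\Omega)$)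 satisfy $(h_v^\Omega u)(n)=E\,u(n)$ for all $n\in\Omega$. Suppose that for some $\alpha$ with $0\le\alpha\le 1$ $$\liminf_{R\to\infty}R^{-\alpha}\sum_{n\in C_R\cap\Omega}|u(n,E)|^2<\infty .$$ Then $D^\alpha\mu^\phi(E)>0$ for every finitely supported $\phi:\Omega\to\mathbb C$ with $\sum_{n}u(n,E)\phi(n)\ne0$. In particular, $D^\alpha\mu^{\delta_{n_0}}(E)>0$ for every $n_0\in\Omega$ with $u(n_0,E)\neq0$, where $\delta_{n_0}$ equals $1$ at $n_0$ and $0$ elsewhere. -/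

import Mathlib

open Filter Topology MeasureTheory
open scoped ENNReal

noncomputable section

/-! ### The lattice `ℤ^d` and the discrete Schrödinger operator -/

/-- The nearest-neighbour graph on `ℤ^d`: `n` and `m` are adjacent iff `|n - m| = 1`
for the Euclidean distance, that is, iff `|n - m|² = 1`. -/
def latticeGraph (d : ℕ) : SimpleGraph (Fin d → ℤ) where
  Adj n m := ∑ i, (n i - m i) ^ 2 = 1
  symm := ⟨fun n m h => by
    rw [← h]; exact Finset.sum_congr rfl fun i _ => by ring⟩
  loopless := ⟨fun n h => by simp at h⟩

theorem finite_setOf_latticeGraph_adj {d : ℕ} (n : Fin d → ℤ) :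
    {m | (latticeGraph d).Adj n m}.Finite := by
  refine (Set.finite_Icc (fun i => n i - 1) (fun i => n i + 1)).subset ?_
  intro m hm
  have key : ∀ i, (n i - m i) ^ 2 ≤ 1 := fun i => by
    have hm' : ∑ i, (n i - m i) ^ 2 = 1 := hm
    rw [← hm']
    exact Finset.single_le_sum (f := fun i => (n i - m i) ^ 2)
      (fun j _ => sq_nonneg _) (Finset.mem_univ i)
  refine ⟨fun i => ?_, fun i => ?_⟩
  · have := key i
    show n i - 1 ≤ m i
    nlinarith
  · have := key i
    show m i ≤ n i + 1
    nlinarith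

theorem finite_setOf_adj_in {d : ℕ} (Ω : Set (Fin d → ℤ)) (n : Ω) :
    {m : Ω | (latticeGraph d).Adj n m}.Finite :=
  (finite_setOf_latticeGraph_adj (n : Fin d → ℤ)).preimage Subtype.val_injective.injOn

/-- The finite set of the points `m ∈ Ω` with `|n - m| = 1`. -/
def neighborsIn {d : ℕ} (Ω : Set (Fin d → ℤ)) (n : Ω) : Finset Ω :=
  (finite_setOf_adj_in Ω n).toFinset

/-- The difference expression
`(h_v^Ω f)(n) = ∑_{|n-m|=1, m ∈ Ω} f(m) + v(n) f(n)`, acting on all functions on `Ω`.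
Neighbours outside `Ω` do not contribute: this is the Dirichlet boundary condition. -/
def schrodingerExpr {d : ℕ} (Ω : Set (Fin d → ℤ)) (v : Ω → ℝ) :
    (Ω → ℂ) →ₗ[ℂ] (Ω → ℂ) where
  toFun f n := ∑ m ∈ neighborsIn Ω n, f m + (v n : ℂ) * f n
  map_add' f g := by
    funext n
    simp only [Pi.add_apply, Finset.sum_add_distrib]
    ring
  map_smul' c f := by
    funext n
    simp only [Pi.smul_apply, smul_eq_mul, RingHom.id_apply, ← Finset.mul_sum]
    ring

/-- The Hilbert space `ℓ²(Ω)`. -/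
abbrev ellTwo {d : ℕ} (Ω : Set (Fin d → ℤ)) : Type := lp (fun _ : Ω => ℂ) 2

/-- The (in general unbounded) Schrödinger operator `h_v^Ω` on `ℓ²(Ω)`, on its natural domain
of all `f ∈ ℓ²(Ω)` with `h_v^Ω f ∈ ℓ²(Ω)`. -/
def schrodingerOp {d : ℕ} (Ω : Set (Fin d → ℤ)) (v : Ω → ℝ) :
    ellTwo Ω →ₗ.[ℂ] ellTwo Ω where
  domain :=
    { carrier := {f | Memℓp (schrodingerExpr Ω v (f : Ω → ℂ)) 2}
      add_mem' := fun {f g} hf hg => by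
        have h := Memℓp.add hf hg
        rw [Set.mem_ofPred_eq, lp.coeFn_add, map_add]
        exact h
      zero_mem' := by
        rw [Set.mem_ofPred_eq, lp.coeFn_zero, map_zero]
        exact zero_memℓp
      smul_mem' := fun c {f} hf => by
        have h := Memℓp.const_smul hf c
        rw [Set.mem_ofPred_eq, lp.coeFn_smul, map_smul]
        exact h }
  toFun :=
    { toFun := fun f => ⟨schrodingerExpr Ω v ((f : ellTwo Ω) : Ω → ℂ), f.2⟩
      map_add' := fun f g => by
        apply Subtype.ext
        exact map_add (schrodingerExpr Ω v) _ _
      map_smul' := fun c f => by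
        apply Subtype.ext
        exact map_smul (schrodingerExpr Ω v) _ _ }

/-- The cube `C_R` of the points of `ℤ^d` with `|n_i| ≤ R` for all `i`. -/
def cube (d : ℕ) (R : ℝ) : Set (Fin d → ℤ) := {n | ∀ i, |(n i : ℝ)| ≤ R}

/-! ### Spectral measures -/

/-- Bounded Borel functions on the line. -/
def IsBoundedBorel (f : ℝ → ℂ) : Prop := Measurable f ∧ ∃ C : ℝ, ∀ t, ‖f t‖ ≤ C

/-- `Φ` is the bounded Borel functional calculus `f ↦ f(A)` of the (unbounded) operator `A`:
a unital `*`-homomorphism on bounded Borel functions, continuous under bounded pointwise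
convergence, that sends `t ↦ (t - z)⁻¹` to the resolvent `(A - z)⁻¹` for all nonreal `z`.
(Only the values of `Φ` on bounded Borel functions matter; these are determined by `A`.) -/
structure IsBorelFunctionalCalculus {H : Type*} [NormedAddCommGroup H] [InnerProductSpace ℂ H]
    [CompleteSpace H] (A : H →ₗ.[ℂ] H) (Φ : (ℝ → ℂ) → H →L[ℂ] H) : Prop where
  map_one : Φ (fun _ => 1) = 1
  map_add : ∀ f g, IsBoundedBorel f → IsBoundedBorel g → Φ (fun t => f t + g t) = Φ f + Φ g
  map_smul : ∀ (c : ℂ) f, IsBoundedBorel f → Φ (fun t => c * f t) = c • Φ f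
  map_mul : ∀ f g, IsBoundedBorel f → IsBoundedBorel g → Φ (fun t => f t * g t) = Φ f * Φ g
  map_star : ∀ f, IsBoundedBorel f →
    Φ (fun t => (starRingEnd ℂ) (f t)) = ContinuousLinearMap.adjoint (Φ f)
  tendsto : ∀ (F : ℕ → ℝ → ℂ) (f : ℝ → ℂ) (C : ℝ), (∀ k, Measurable (F k)) →
    (∀ k t, ‖F k t‖ ≤ C) → (∀ t, Tendsto (fun k => F k t) atTop (𝓝 (f t))) →
    ∀ ψ, Tendsto (fun k => Φ (F k) ψ) atTop (𝓝 (Φ f ψ))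
  resolvent_right : ∀ z : ℂ, z.im ≠ 0 → ∀ ψ : H,
    ∃ h : Φ (fun t => ((t : ℂ) - z)⁻¹) ψ ∈ A.domain,
      A ⟨Φ (fun t => ((t : ℂ) - z)⁻¹) ψ, h⟩ - z • Φ (fun t => ((t : ℂ) - z)⁻¹) ψ = ψ
  resolvent_left : ∀ z : ℂ, z.im ≠ 0 → ∀ ψ : A.domain,
    Φ (fun t => ((t : ℂ) - z)⁻¹) (A ψ - z • (ψ : H)) = ψ

/-- `μ` is a spectral measure of `A` at `φ`: a finite Borel measure on `ℝ` with
`∫ f dμ = (f(A) φ, φ)` for all bounded Borel functions `f`.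
(Mathlib's inner product is linear in the second argument.) -/
def IsSpectralMeasure {H : Type*} [NormedAddCommGroup H] [InnerProductSpace ℂ H]
    [CompleteSpace H] (A : H →ₗ.[ℂ] H) (φ : H) (μ : Measure ℝ) : Prop :=
  IsFiniteMeasure μ ∧ ∃ Φ : (ℝ → ℂ) → H →L[ℂ] H, IsBorelFunctionalCalculus A Φ ∧
    ∀ f, IsBoundedBorel f → ∫ t, f t ∂μ = inner ℂ φ (Φ f φ)

open Classical in
/-- The spectral measure `μ^φ` of `A` at `φ`. The value `0` is used only if there is none,
which does not happen for a self-adjoint operator. -/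
def spectralMeasure {H : Type*} [NormedAddCommGroup H] [InnerProductSpace ℂ H]
    [CompleteSpace H] (A : H →ₗ.[ℂ] H) (φ : H) : Measure ℝ :=
  if h : ∃ μ : Measure ℝ, IsSpectralMeasure A φ μ then h.choose else 0

/-- The upper `α`-derivative
`D^α μ(E) = limsup_{δ → 0+} μ(E - δ, E + δ) / δ^α`, with values in `[0, ∞]`. -/
def upperDeriv (α : ℝ) (μ : Measure ℝ) (E : ℝ) : ℝ≥0∞ :=
  limsup (fun δ : ℝ => μ (Set.Ioo (E - δ) (E + δ)) / ENNReal.ofReal (δ ^ α)) (𝓝[>] 0)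

end

/-! Let `ε = 1/R`, `z = E + iε`, and cut the conjugate of `u` off to `w = χ_R ū`, where `χ_R` has
slope `1/R`. Since `ū` also solves the equation, `(h - E)w` is only the commutator of the adjacency
operator with `χ_R`, so `‖(h - z)w‖² ≤ C R⁻² ∑_{C_R}|u|²` (`exists_cutoff_solution`). Writing `w =
(h - z)⁻¹(h - z)w` and moving the resolvent onto `φ`, Cauchy–Schwarz gives `|(w, φ)|² ≤ ‖(h - z)w‖²
∫ dμ^φ(t) / ((t - E)² + ε²)` (`norm_inner_sq_le_of_isSpectralMeasure`).

If `D^α μ^φ(E) = 0`, a dyadic decomposition makes the integral `o(ε^(α-2))`. Along scales where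
`∑_{C_R}|u|² ≤ L R^α`, the powers of `R` cancel and the right side becomes arbitrarily small, while
the left side tends to `|∑ u φ|² ≠ 0`.

The argument needs `spectralMeasure` to be a genuine spectral measure rather than its default value.
Existence is proved by the spectral theorem: the resolvent at `il`, for large `l`, comes from a
Neumann series; it is normal, its continuous functional calculus extends to Borel functions by Riesz
representation, and the spectrum is carried to the line by `x ↦ Re x⁻¹`. -/

noncomputable section

/-! ### Borel functional calculus of a representation of `C(X, ℂ)` -/

section CompactCalculus

variable {X : Type*} [MetricSpace X] [CompactSpace X] [MeasurableSpace X] [BorelSpace X]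
  {H : Type*} [NormedAddCommGroup H] [InnerProductSpace ℂ H] [CompleteSpace H]

theorem inner_starAlgHom_apply {X : Type*} [TopologicalSpace X]
    (π : C(X, ℂ) →⋆ₐ[ℂ] (H →L[ℂ] H)) (f g : C(X, ℂ)) (x y : H) :
    inner ℂ (π f x) (π g y) = inner ℂ x (π (star f * g) y) := by
  rw [map_mul, map_star, mul_apply_eq_comp, ContinuousLinearMap.star_eq_adjoint,
    ContinuousLinearMap.adjoint_inner_right]

/-- The complexification of a real continuous function. -/
def complexify (f : C(X, ℝ)) : C(X, ℂ) :=
  ⟨fun x => (f x : ℂ), by fun_prop⟩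

/-- The functional `f ↦ (π(f) ψ, ψ)` on real functions. -/
def vectorFunctional (π : C(X, ℂ) →⋆ₐ[ℂ] (H →L[ℂ] H)) (ψ : H) :
    CompactlySupportedContinuousMap X ℝ →ₗ[ℝ] ℝ where
  toFun f := (inner ℂ ψ (π (complexify f.toContinuousMap) ψ)).re
  map_add' f g := by
    have : complexify (f + g).toContinuousMap
        = complexify f.toContinuousMap + complexify g.toContinuousMap := by
      ext x; simp [complexify]
    rw [this, map_add, _root_.add_apply, inner_add_right, Complex.add_re]
  map_smul' c f := by
    have : complexify (c • f).toContinuousMap = (c : ℂ) • complexify f.toContinuousMap := by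
      ext x; simp [complexify]
    rw [this, map_smul, _root_.smul_apply, inner_smul_right, Complex.re_ofReal_mul]
    rfl

/-- Since `f = |√f|²`, the functional at `f` is `‖π(√f)ψ‖²`. -/
theorem vectorFunctional_nonneg {X : Type*} [MetricSpace X] (π : C(X, ℂ) →⋆ₐ[ℂ] (H →L[ℂ] H)) (ψ : H)
    (f : CompactlySupportedContinuousMap X ℝ) (hf : 0 ≤ f) : 0 ≤ vectorFunctional π ψ f := by
  let s : C(X, ℝ) := ⟨fun x => Real.sqrt (f x), f.continuous.sqrt⟩
  have h : complexify f.toContinuousMap = star (complexify s) * complexify s := by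
    ext x
    change ((f x : ℝ) : ℂ) = (starRingEnd ℂ) ((Real.sqrt (f x) : ℝ) : ℂ) * ((Real.sqrt (f x) : ℝ) : ℂ)
    rw [Complex.conj_ofReal, ← Complex.ofReal_mul, Real.mul_self_sqrt (hf x)]
  change 0 ≤ (inner ℂ ψ (π (complexify f.toContinuousMap) ψ)).re
  rw [h, ← inner_starAlgHom_apply]
  exact inner_self_nonneg (𝕜 := ℂ)

theorem exists_measure_integral_norm_sq (π : C(X, ℂ) →⋆ₐ[ℂ] (H →L[ℂ] H)) (ψ : H) :
    ∃ μ : Measure X, IsFiniteMeasure μ ∧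
      ∀ f : C(X, ℂ), ∫ x, ‖f x‖ ^ 2 ∂μ = ‖π f ψ‖ ^ 2 := by
  let Λ : CompactlySupportedContinuousMap X ℝ →ₚ[ℝ] ℝ :=
    PositiveLinearMap.mk₀ (vectorFunctional π ψ) (vectorFunctional_nonneg π ψ)
  refine ⟨RealRMK.rieszMeasure Λ, inferInstance, fun f => ?_⟩
  have hc : Continuous fun x => ‖f x‖ ^ 2 := by fun_prop
  let g : CompactlySupportedContinuousMap X ℝ :=
    CompactlySupportedContinuousMap.continuousMapEquiv ⟨_, hc⟩
  have hg := RealRMK.integral_rieszMeasure Λ g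
  have h2 : complexify g.toContinuousMap = star f * f := by
    ext x
    change ((‖f x‖ ^ 2 : ℝ) : ℂ) = (starRingEnd ℂ) (f x) * f x
    rw [← Complex.normSq_eq_conj_mul_self, Complex.normSq_eq_norm_sq]
  refine hg.trans ?_
  change (inner ℂ ψ (π (complexify g.toContinuousMap) ψ)).re = _
  rw [h2, ← inner_starAlgHom_apply, inner_self_eq_norm_sq_to_K]
  norm_cast

/-- The map `f ↦ π(f)ψ` preserves the `L²(μ)` norm on continuous functions, which are dense, so it
extends by continuity. -/
theorem exists_isometry_Lp (π : C(X, ℂ) →⋆ₐ[ℂ] (H →L[ℂ] H)) (ψ : H) :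
    ∃ μ : Measure X, ∃ _ : IsFiniteMeasure μ, ∃ U : Lp ℂ 2 μ →ₗᵢ[ℂ] H,
      ∀ f : C(X, ℂ), U (ContinuousMap.toLp 2 μ ℂ f) = π f ψ := by
  obtain ⟨μ, hμ, h⟩ := exists_measure_integral_norm_sq π ψ
  refine ⟨μ, hμ, ?_⟩
  let e : C(X, ℂ) →ₗ[ℂ] Lp ℂ 2 μ := (ContinuousMap.toLp 2 μ ℂ).toLinearMap
  let p : C(X, ℂ) →ₗ[ℂ] H :=
    { toFun := fun f => π f ψ
      map_add' := fun f g => by simp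
      map_smul' := fun c f => by simp }
  have hd : DenseRange e := ContinuousMap.toLp_denseRange ℂ μ ℂ (by norm_num)
  have hn : ∀ f, ‖p f‖ = ‖e f‖ := by
    intro f
    have h1 : ‖e f‖ ^ 2 = ∫ x, ‖f x‖ ^ 2 ∂μ := by
      have := L2.inner_def (𝕜 := ℂ) (e f) (e f)
      rw [inner_self_eq_norm_sq_to_K] at this
      have h3 : ∫ a, inner ℂ ((e f : X → ℂ) a) ((e f : X → ℂ) a) ∂μ
          = ∫ a, ((‖f a‖ ^ 2 : ℝ) : ℂ) ∂μ := by
        refine integral_congr_ae ?_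
        filter_upwards [ContinuousMap.coeFn_toLp (p := 2) (𝕜 := ℂ) μ f] with a ha
        change inner ℂ ((ContinuousMap.toLp 2 μ ℂ f : X → ℂ) a) ((ContinuousMap.toLp 2 μ ℂ f : X → ℂ) a) = _
        rw [ha, inner_self_eq_norm_sq_to_K]
        norm_cast
      have h4 : ∫ a, ((‖f a‖ ^ 2 : ℝ) : ℂ) ∂μ = ((∫ a, ‖f a‖ ^ 2 ∂μ : ℝ) : ℂ) := integral_ofReal
      rw [h3, h4] at this
      exact Complex.ofReal_injective ((Complex.ofReal_pow _ _).trans this)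
    rw [h f] at h1
    exact ((pow_left_inj₀ (norm_nonneg _) (norm_nonneg _) two_ne_zero).1 h1).symm
  have hb : ∀ f, ‖p f‖ ≤ 1 * ‖e f‖ := fun f => by rw [hn, one_mul]
  have he : ∀ f, p.extendOfNorm e (e f) = p f := LinearMap.extendOfNorm_eq hd ⟨1, hb⟩
  refine ⟨⟨(p.extendOfNorm e).toLinearMap, fun x => ?_⟩, he⟩
  change ‖p.extendOfNorm e x‖ = ‖x‖
  refine hd.induction_on x ?_ fun f => ?_
  · exact isClosed_eq (by fun_prop) (by fun_prop)
  · rw [he, hn]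

/-- Bounded measurable complex functions. -/
def IsBddMeas {X : Type*} [MeasurableSpace X] (f : X → ℂ) : Prop :=
  Measurable f ∧ ∃ C : ℝ, ∀ x, ‖f x‖ ≤ C

theorem IsBddMeas.memLp {X : Type*} [MeasurableSpace X] {f : X → ℂ} (hf : IsBddMeas f)
    (μ : Measure X) [IsFiniteMeasure μ] (p : ℝ≥0∞) : MemLp f p μ :=
  MemLp.of_bound hf.1.aestronglyMeasurable hf.2.choose (ae_of_all _ hf.2.choose_spec)

theorem ContinuousMap.isBddMeas (f : C(X, ℂ)) : IsBddMeas f :=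
  ⟨f.continuous.measurable, ‖f‖, f.norm_coe_le_norm⟩

theorem IsBddMeas.add {X : Type*} [MeasurableSpace X] {f g : X → ℂ} (hf : IsBddMeas f)
    (hg : IsBddMeas g) : IsBddMeas fun x => f x + g x := by
  obtain ⟨a, ha⟩ := hf.2
  obtain ⟨b, hb⟩ := hg.2
  exact ⟨hf.1.add hg.1, a + b, fun x => (norm_add_le _ _).trans (add_le_add (ha x) (hb x))⟩

theorem IsBddMeas.mul {X : Type*} [MeasurableSpace X] {f g : X → ℂ} (hf : IsBddMeas f)
    (hg : IsBddMeas g) : IsBddMeas fun x => f x * g x := by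
  obtain ⟨a, ha⟩ := hf.2
  obtain ⟨b, hb⟩ := hg.2
  refine ⟨hf.1.mul hg.1, a * b, fun x => ?_⟩
  rw [norm_mul]
  exact mul_le_mul (ha x) (hb x) (norm_nonneg _) ((norm_nonneg _).trans (ha x))

theorem IsBddMeas.star {X : Type*} [MeasurableSpace X] {f : X → ℂ} (hf : IsBddMeas f) :
    IsBddMeas fun x => (starRingEnd ℂ) (f x) := by
  obtain ⟨a, ha⟩ := hf.2
  exact ⟨Complex.continuous_conj.measurable.comp hf.1, a, fun x => by simpa using ha x⟩

theorem isBddMeas_const {X : Type*} [MeasurableSpace X] (c : ℂ) :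
    IsBddMeas fun _ : X => c := ⟨measurable_const, ‖c‖, fun _ => le_rfl⟩

variable (π : C(X, ℂ) →⋆ₐ[ℂ] (H →L[ℂ] H))

/-- The measure on `X` representing `f ↦ (π(f) ψ, ψ)`. -/
def vectorMeasure (ψ : H) : Measure X := (exists_isometry_Lp π ψ).choose

instance (ψ : H) : IsFiniteMeasure (vectorMeasure π ψ) :=
  (exists_isometry_Lp π ψ).choose_spec.choose

/-- The isometry of `L²(μ_ψ)` onto the cyclic subspace of `ψ`. -/
def cyclicIsometry (ψ : H) : Lp ℂ 2 (vectorMeasure π ψ) →ₗᵢ[ℂ] H :=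
  (exists_isometry_Lp π ψ).choose_spec.choose_spec.choose

theorem cyclicIsometry_toLp (ψ : H) (f : C(X, ℂ)) :
    cyclicIsometry π ψ (ContinuousMap.toLp 2 (vectorMeasure π ψ) ℂ f) = π f ψ :=
  (exists_isometry_Lp π ψ).choose_spec.choose_spec.choose_spec f

/-- The vector `f(T) ψ` for a bounded Borel function `f`. -/
def borelVector {f : X → ℂ} (hf : IsBddMeas f) (ψ : H) : H :=
  cyclicIsometry π ψ ((hf.memLp (vectorMeasure π ψ) 2).toLp f)

theorem borelVector_continuousMap (f : C(X, ℂ)) (hf : IsBddMeas f) (ψ : H) :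
    borelVector π hf ψ = π f ψ := by
  rw [← cyclicIsometry_toLp, borelVector]
  congr 1

theorem norm_borelVector_sub {f g : X → ℂ} (hf : IsBddMeas f) (hg : IsBddMeas g) (ψ : H) :
    ‖borelVector π hf ψ - borelVector π hg ψ‖
      = (eLpNorm (f - g) 2 (vectorMeasure π ψ)).toReal := by
  rw [borelVector, borelVector, ← map_sub, LinearIsometry.norm_map, ← MemLp.toLp_sub,
    Lp.norm_toLp]

theorem tendsto_borelVector {F : ℕ → X → ℂ} {f : X → ℂ} (hF : ∀ k, IsBddMeas (F k))
    (hf : IsBddMeas f) (ψ : H)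
    (h : Tendsto (fun k => eLpNorm (F k - f) 2 (vectorMeasure π ψ)) atTop (𝓝 0)) :
    Tendsto (fun k => borelVector π (hF k) ψ) atTop (𝓝 (borelVector π hf ψ)) := by
  rw [tendsto_iff_norm_sub_tendsto_zero]
  simp only [norm_borelVector_sub]
  exact (ENNReal.tendsto_toReal ENNReal.zero_ne_top).comp h

theorem tendsto_starAlgHom {F : ℕ → C(X, ℂ)} {f : X → ℂ}
    (hf : IsBddMeas f) (ψ : H)
    (h : Tendsto (fun k => eLpNorm (⇑(F k) - f) 2 (vectorMeasure π ψ)) atTop (𝓝 0)) :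
    Tendsto (fun k => π (F k) ψ) atTop (𝓝 (borelVector π hf ψ)) := by
  simpa only [borelVector_continuousMap] using
    tendsto_borelVector π (fun k => (F k).isBddMeas) hf ψ h

/-- The measures of different vectors are unrelated; approximating in `L²` of their sum gives one
sequence that serves all of them. Algebraic identities then pass from continuous to Borel functions
by uniqueness of limits. -/
theorem exists_continuousMap_tendsto {f : X → ℂ} (hf : IsBddMeas f) (S : Finset H) :
    ∃ F : ℕ → C(X, ℂ), ∀ ψ ∈ S,
      Tendsto (fun k => eLpNorm (⇑(F k) - f) 2 (vectorMeasure π ψ)) atTop (𝓝 0) := by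
  let ν : Measure X := ∑ ψ ∈ S, vectorMeasure π ψ
  have hν : ∀ ψ ∈ S, vectorMeasure π ψ ≤ ν := fun ψ hψ =>
    Finset.single_le_sum (f := fun ψ => vectorMeasure π ψ) (fun _ _ => Measure.zero_le _) hψ
  have hfin : IsFiniteMeasure ν := by
    refine ⟨?_⟩
    simp only [ν, Measure.finsetSum_apply]
    exact ENNReal.sum_lt_top.2 fun ψ _ => measure_lt_top _ _
  have key : ∀ k : ℕ, ∃ g : C(X, ℂ), eLpNorm (⇑g - f) 2 ν ≤ ((k : ℝ≥0∞) + 1)⁻¹ := by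
    intro k
    obtain ⟨g, hg, -⟩ := (hf.memLp ν 2).exists_boundedContinuous_eLpNorm_sub_le (by norm_num)
      (ε := ((k : ℝ≥0∞) + 1)⁻¹) (by simp)
    refine ⟨g.toContinuousMap, ?_⟩
    rw [eLpNorm_sub_comm]
    exact hg
  choose F hF using key
  refine ⟨F, fun ψ hψ => ?_⟩
  refine tendsto_of_tendsto_of_tendsto_of_le_of_le tendsto_const_nhds
    ?_ (fun _ => zero_le) fun k =>
      (eLpNorm_mono_measure _ (hν ψ hψ)).trans (hF k)
  have := (ENNReal.tendsto_inv_nat_nhds_zero).comp (tendsto_add_atTop_nat 1)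
  refine this.congr fun k => ?_
  simp

theorem borelVector_add {f : X → ℂ} (hf : IsBddMeas f) (ψ χ : H) :
    borelVector π hf (ψ + χ) = borelVector π hf ψ + borelVector π hf χ := by
  classical
  obtain ⟨F, hF⟩ := exists_continuousMap_tendsto π hf {ψ + χ, ψ, χ}
  have h1 := tendsto_starAlgHom π hf (ψ + χ) (hF _ (by simp))
  have h2 := (tendsto_starAlgHom π hf ψ (hF _ (by simp))).add
    (tendsto_starAlgHom π hf χ (hF _ (by simp)))
  simp only [map_add] at h1
  exact tendsto_nhds_unique h1 h2

theorem borelVector_smul {f : X → ℂ} (hf : IsBddMeas f) (c : ℂ) (ψ : H) :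
    borelVector π hf (c • ψ) = c • borelVector π hf ψ := by
  classical
  obtain ⟨F, hF⟩ := exists_continuousMap_tendsto π hf {c • ψ, ψ}
  have h1 := tendsto_starAlgHom π hf (c • ψ) (hF _ (by simp))
  have h2 := (tendsto_starAlgHom π hf ψ (hF _ (by simp))).const_smul c
  simp only [map_smul] at h1
  exact tendsto_nhds_unique h1 h2

theorem norm_borelVector_le {f : X → ℂ} (hf : IsBddMeas f) {C : ℝ} (hC : 0 ≤ C)
    (h : ∀ x, ‖f x‖ ≤ C) (ψ : H) : ‖borelVector π hf ψ‖ ≤ C * ‖ψ‖ := by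
  -- The isometry sends the constant `1` to `ψ`, so `C‖ψ‖` is the `L²` norm of the constant `C`,
  -- which dominates `f` pointwise.
  have h1 : ‖(C : ℂ) • ψ‖ = ‖((isBddMeas_const (C : ℂ)).memLp (vectorMeasure π ψ) 2).toLp
      (fun _ => (C : ℂ))‖ := by
    rw [← (cyclicIsometry π ψ).norm_map]
    congr 1
    have h2 := borelVector_continuousMap π (ContinuousMap.const X (C : ℂ))
      (isBddMeas_const (C : ℂ)) ψ
    have h3 : ContinuousMap.const X (C : ℂ) = (C : ℂ) • 1 := by ext; simp
    refine Eq.trans ?_ h2.symm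
    rw [h3, map_smul, map_one]
    rfl
  rw [norm_smul, Complex.norm_real, Real.norm_of_nonneg hC] at h1
  rw [h1, borelVector, LinearIsometry.norm_map]
  refine Lp.norm_le_norm_of_ae_le ?_
  filter_upwards [MemLp.coeFn_toLp (hf.memLp (vectorMeasure π ψ) 2),
    MemLp.coeFn_toLp ((isBddMeas_const (C : ℂ)).memLp (vectorMeasure π ψ) 2)] with x h3 h4
  rw [h3, h4, Complex.norm_real, Real.norm_of_nonneg hC]
  exact h x

open Classical in
/-- The bounded Borel functional calculus of a representation of `C(X, ℂ)`. -/
def borelCalculus (f : X → ℂ) : H →L[ℂ] H :=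
  if hf : IsBddMeas f then
    LinearMap.mkContinuous
      { toFun := borelVector π hf
        map_add' := borelVector_add π hf
        map_smul' := borelVector_smul π hf } (max hf.2.choose 0)
      (norm_borelVector_le π hf (le_max_right _ _) fun x =>
        (hf.2.choose_spec x).trans (le_max_left _ _))
  else 0

theorem borelCalculus_apply {f : X → ℂ} (hf : IsBddMeas f) (ψ : H) :
    borelCalculus π f ψ = borelVector π hf ψ := by
  rw [borelCalculus, dif_pos hf]
  rfl

theorem borelCalculus_continuousMap (f : C(X, ℂ)) : borelCalculus π f = π f := by
  ext ψ
  rw [borelCalculus_apply π f.isBddMeas, borelVector_continuousMap]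

theorem borelCalculus_add {f g : X → ℂ} (hf : IsBddMeas f) (hg : IsBddMeas g) :
    borelCalculus π (fun x => f x + g x) = borelCalculus π f + borelCalculus π g := by
  ext ψ
  rw [_root_.add_apply, borelCalculus_apply π hf, borelCalculus_apply π hg,
    borelCalculus_apply π (hf.add hg), borelVector, borelVector, borelVector, ← map_add,
    ← MemLp.toLp_add]
  rfl

theorem borelCalculus_smul (c : ℂ) {f : X → ℂ} (hf : IsBddMeas f) :
    borelCalculus π (fun x => c * f x) = c • borelCalculus π f := by
  ext ψ
  rw [_root_.smul_apply, borelCalculus_apply π hf,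
    borelCalculus_apply π ((isBddMeas_const c).mul hf), borelVector, borelVector, ← map_smul,
    ← MemLp.toLp_const_smul]
  rfl

theorem tendsto_eLpNorm_mul {X : Type*} [MeasurableSpace X] {μ : Measure X} {F : ℕ → X → ℂ} {f g : X → ℂ}
    (hg : IsBddMeas g)
    (h : Tendsto (fun k => eLpNorm (F k - f) 2 μ) atTop (𝓝 0)) :
    Tendsto (fun k => eLpNorm ((fun x => F k x * g x) - fun x => f x * g x) 2 μ) atTop (𝓝 0) := by
  obtain ⟨C, hC⟩ := hg.2
  refine tendsto_of_tendsto_of_tendsto_of_le_of_le tendsto_const_nhds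
    (h := fun k => ENNReal.ofReal C * eLpNorm (F k - f) 2 μ) ?_ (fun _ => zero_le) fun k => ?_
  · simpa using ENNReal.Tendsto.const_mul h (Or.inr ENNReal.ofReal_ne_top)
  · refine eLpNorm_le_mul_eLpNorm_of_ae_le_mul (ae_of_all _ fun x => ?_) 2
    rw [Pi.sub_apply, ← sub_mul, norm_mul, mul_comm]
    exact mul_le_mul_of_nonneg_right (hC x) (norm_nonneg _)

/-- Multiplicativity is extended one factor at a time; here only the second factor is Borel. -/
theorem borelCalculus_continuousMap_mul (f : C(X, ℂ)) {g : X → ℂ} (hg : IsBddMeas g) (ψ : H) :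
    π f (borelCalculus π g ψ) = borelVector π (f.isBddMeas.mul hg) ψ := by
  obtain ⟨G, hG⟩ := exists_continuousMap_tendsto π hg {ψ}
  have h1 := hG ψ (by simp)
  have h2 := (π f).continuous.continuousAt.tendsto.comp (tendsto_starAlgHom π hg ψ h1)
  rw [borelCalculus_apply π hg]
  refine tendsto_nhds_unique h2 ?_
  have h3 := tendsto_eLpNorm_mul f.isBddMeas h1
  have h4 := tendsto_borelVector π (fun k => (G k).isBddMeas.mul f.isBddMeas)
    (hg.mul f.isBddMeas) ψ h3
  convert h4 using 1
  · funext k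
    have : (fun x => G k x * f x) = ⇑(f * G k) := by
      funext x; simp [mul_comm]
    simp only [Function.comp_apply, this]
    rw [borelVector_continuousMap, map_mul]
    rfl
  · simp only [mul_comm]

theorem borelCalculus_mul {f g : X → ℂ} (hf : IsBddMeas f) (hg : IsBddMeas g) :
    borelCalculus π (fun x => f x * g x) = borelCalculus π f * borelCalculus π g := by
  classical
  ext ψ
  rw [mul_apply_eq_comp, borelCalculus_apply π (hf.mul hg), borelCalculus_apply π hf]
  obtain ⟨F, hF⟩ := exists_continuousMap_tendsto π hf {ψ, borelCalculus π g ψ}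
  have h1 := tendsto_starAlgHom π hf _ (hF (borelCalculus π g ψ) (by simp))
  have h2 := tendsto_eLpNorm_mul hg (hF ψ (by simp))
  have h3 := tendsto_borelVector π (fun k => (F k).isBddMeas.mul hg) (hf.mul hg) ψ h2
  simp only [borelCalculus_continuousMap_mul π _ hg] at h1
  exact tendsto_nhds_unique h3 h1

theorem borelCalculus_star {f : X → ℂ} (hf : IsBddMeas f) :
    borelCalculus π (fun x => (starRingEnd ℂ) (f x))
      = ContinuousLinearMap.adjoint (borelCalculus π f) := by
  classical
  rw [ContinuousLinearMap.eq_adjoint_iff]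
  intro x y
  rw [borelCalculus_apply π hf, borelCalculus_apply π hf.star]
  obtain ⟨F, hF⟩ := exists_continuousMap_tendsto π hf {x, y}
  have h1 := tendsto_starAlgHom π hf y (hF y (by simp))
  have h2 : Tendsto (fun k => eLpNorm (⇑(star (F k)) - fun x => (starRingEnd ℂ) (f x)) 2
      (vectorMeasure π x)) atTop (𝓝 0) := by
    refine (hF x (by simp)).congr fun k => eLpNorm_congr_norm_ae (ae_of_all _ fun t => ?_)
    simp [← map_sub]
  have h3 := tendsto_starAlgHom π hf.star x h2
  refine tendsto_nhds_unique (h3.inner tendsto_const_nhds)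
    (((tendsto_const_nhds (x := x)).inner h1).congr fun k => ?_)
  rw [map_star, ContinuousLinearMap.star_eq_adjoint, ContinuousLinearMap.adjoint_inner_left]

theorem tendsto_borelCalculus {F : ℕ → X → ℂ} {f : X → ℂ} {C : ℝ} (hF : ∀ k, Measurable (F k))
    (hC : ∀ k x, ‖F k x‖ ≤ C) (h : ∀ x, Tendsto (fun k => F k x) atTop (𝓝 (f x))) (ψ : H) :
    Tendsto (fun k => borelCalculus π (F k) ψ) atTop (𝓝 (borelCalculus π f ψ)) := by
  have hF' : ∀ k, IsBddMeas (F k) := fun k => ⟨hF k, C, hC k⟩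
  have hf : IsBddMeas f := ⟨measurable_of_tendsto_metrizable hF (tendsto_pi_nhds.2 h), C,
    fun x => le_of_tendsto (h x).norm (Eventually.of_forall fun k => hC k x)⟩
  simp only [fun k => borelCalculus_apply π (hF' k), borelCalculus_apply π hf]
  refine tendsto_borelVector π hF' hf ψ ?_
  refine tendsto_Lp_finite_of_tendsto_ae (by norm_num) (by norm_num)
    (fun k => (hF k).aestronglyMeasurable) (hf.memLp _ 2) ?_ (ae_of_all _ h)
  -- Vitali's theorem applies: above the level `C + 1` the truncated functions vanish identically.
  refine unifIntegrable_of (by norm_num) (by norm_num) (fun k => (hF k).aestronglyMeasurable)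
    fun ε hε => ⟨Real.toNNReal C + 1, fun k => ?_⟩
  have : {x | Real.toNNReal C + 1 ≤ ‖F k x‖₊} = ∅ := by
    ext x
    simp only [Set.mem_ofPred_eq, Set.mem_empty_iff_false, iff_false, not_le]
    have h1 : ‖F k x‖₊ ≤ Real.toNNReal C := by
      rw [← NNReal.coe_le_coe]
      exact (hC k x).trans (Real.le_coe_toNNReal C)
    exact h1.trans_lt (lt_add_one _)
  rw [this]
  simp

theorem integral_vectorMeasure {f : X → ℂ} (hf : IsBddMeas f) (ψ : H) :
    ∫ x, f x ∂(vectorMeasure π ψ) = inner ℂ ψ (borelCalculus π f ψ) := by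
  have h1 : borelVector π (isBddMeas_const 1) ψ = ψ := by
    have h2 := borelVector_continuousMap π (1 : C(X, ℂ)) (isBddMeas_const 1) ψ
    simpa using h2
  have h2 : inner ℂ ψ (borelCalculus π f ψ)
      = inner ℂ (borelVector π (isBddMeas_const 1) ψ) (borelVector π hf ψ) := by
    rw [h1, borelCalculus_apply π hf]
  rw [h2, borelVector, borelVector, LinearIsometry.inner_map_map, L2.inner_def]
  refine integral_congr_ae ?_
  filter_upwards [MemLp.coeFn_toLp (hf.memLp (vectorMeasure π ψ) 2),
    MemLp.coeFn_toLp ((isBddMeas_const (1 : ℂ)).memLp (vectorMeasure π ψ) 2)] with x h3 h4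
  rw [h3, h4]
  simp

end CompactCalculus

/-! ### From one normal resolvent to the calculus of an unbounded operator -/

section Transfer

variable {H : Type*} [NormedAddCommGroup H] [InnerProductSpace ℂ H]

/-- `T` is the bounded inverse of `A - z`. -/
structure IsResolventAt (A : H →ₗ.[ℂ] H) (z : ℂ) (T : H →L[ℂ] H) : Prop where
  right : ∀ ψ : H, ∃ h : T ψ ∈ A.domain, A ⟨T ψ, h⟩ - z • T ψ = ψ
  left : ∀ ψ : A.domain, T (A ψ - z • (ψ : H)) = ψ

theorem IsResolventAt.injective {A : H →ₗ.[ℂ] H} {z : ℂ} {T : H →L[ℂ] H}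
    (hT : IsResolventAt A z T) {ψ : H} (h : T ψ = 0) : ψ = 0 := by
  obtain ⟨h1, h2⟩ := hT.right ψ
  have h3 : (⟨T ψ, h1⟩ : A.domain) = 0 := Subtype.ext h
  rw [h3, LinearPMap.map_zero, h, smul_zero, sub_zero] at h2
  exact h2.symm

/-- The first resolvent identity: apply the left inverse `S` of `A - w` to `(A - w)Tψ = ψ + (z -
w)Tψ`. -/
theorem IsResolventAt.sub_apply {A : H →ₗ.[ℂ] H} {z w : ℂ} {T S : H →L[ℂ] H}
    (hT : IsResolventAt A z T) (hS : IsResolventAt A w S) (ψ : H) :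
    T ψ = S ψ + (z - w) • S (T ψ) := by
  obtain ⟨h1, h2⟩ := hT.right ψ
  have h3 := hS.left ⟨T ψ, h1⟩
  have h4 : A ⟨T ψ, h1⟩ - w • T ψ = ψ + (z - w) • T ψ := by
    rw [sub_smul, add_sub, ← sub_left_inj (a := z • T ψ), sub_right_comm, h2]
    abel
  rw [h4, map_add, map_smul] at h3
  exact h3.symm

/-- The map `z ↦ Re z⁻¹` from the spectrum of `(A - il)⁻¹` to the line. -/
def spectrumToLine (T : H →L[ℂ] H) (x : spectrum ℂ T) : ℝ := ((x : ℂ)⁻¹).re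

theorem measurable_spectrumToLine (T : H →L[ℂ] H) : Measurable (spectrumToLine T) :=
  Complex.measurable_re.comp (measurable_inv.comp measurable_subtype_coe)

variable [CompleteSpace H]

/-- The resolvent identity taken in both orders gives `2il T*T = T - T* = 2il TT*`. -/
theorem isStarNormal_of_isResolventAt {A : H →ₗ.[ℂ] H} {l : ℝ} (hl : l ≠ 0) {T : H →L[ℂ] H}
    (hT : IsResolventAt A (Complex.I * l) T)
    (hS : IsResolventAt A (-(Complex.I * l)) (star T)) : IsStarNormal T := by
  refine ⟨?_⟩
  ext ψ
  have h1 := hT.sub_apply hS ψ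
  have h2 := hS.sub_apply hT ψ
  rw [mul_apply_eq_comp, mul_apply_eq_comp]
  have h3 : (2 * (Complex.I * l)) • (star T (T ψ)) = T ψ - star T ψ := by
    rw [eq_sub_iff_add_eq]
    refine Eq.trans ?_ h1.symm
    rw [add_comm]
    congr 2
    ring
  have h4 : (2 * (Complex.I * l)) • (T (star T ψ)) = T ψ - star T ψ := by
    rw [eq_sub_iff_add_eq]
    nth_rewrite 2 [h2]
    rw [add_comm, add_assoc, ← add_smul]
    convert add_zero _
    convert zero_smul ℂ _
    ring
  exact smul_right_injective H (r := 2 * (Complex.I * l)) (by simpa using hl) (h3.trans h4.symm)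

/-- On the spectrum of `T = (A - il)⁻¹` one has `z - z̄ = 2il|z|²`. -/
theorem sub_conj_eq_of_mem_spectrum {A : H →ₗ.[ℂ] H} {l : ℝ} {T : H →L[ℂ] H}
    (hT : IsResolventAt A (Complex.I * l) T)
    (hS : IsResolventAt A (-(Complex.I * l)) (star T)) (hn : IsStarNormal T)
    (x : spectrum ℂ T) : (x : ℂ) - (starRingEnd ℂ) x = 2 * (Complex.I * l) * ((starRingEnd ℂ) x * x) := by
  let i : C(spectrum ℂ T, ℂ) := (ContinuousMap.id ℂ).restrict (spectrum ℂ T)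
  have hi : cfcHom hn i = T := cfcHom_id hn
  have h : i - star i = (2 * (Complex.I * l)) • (star i * i) := by
    apply cfcHom_injective hn
    rw [map_sub, map_smul, map_mul, map_star, hi]
    ext ψ
    have h1 := hT.sub_apply hS ψ
    change T ψ - star T ψ = (2 * (Complex.I * l)) • (star T (T ψ))
    rw [sub_eq_iff_eq_add]
    nth_rewrite 1 [h1]
    rw [add_comm]
    congr 2
    ring
  exact congrArg (fun f : C(spectrum ℂ T, ℂ) => f x) h

/-- The circle identity says that `x⁻¹` has imaginary part `-l`. The excluded point `x = 0` plays
the role of infinity on the line. -/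
theorem mul_spectrumToLine {A : H →ₗ.[ℂ] H} {l : ℝ} {T : H →L[ℂ] H}
    (hT : IsResolventAt A (Complex.I * l) T)
    (hS : IsResolventAt A (-(Complex.I * l)) (star T)) (hn : IsStarNormal T)
    (x : spectrum ℂ T) (hx : (x : ℂ) ≠ 0) :
    (x : ℂ) * ((spectrumToLine T x : ℂ) - Complex.I * l) = 1 := by
  have h := sub_conj_eq_of_mem_spectrum hT hS hn x
  rw [mul_comm, mul_eq_one_iff_eq_inv₀ hx]
  have h0 : (starRingEnd ℂ) (x : ℂ) ≠ 0 := by simpa using hx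
  have h1 : (x : ℂ)⁻¹ - (starRingEnd ℂ) (x : ℂ)⁻¹ = - (2 * (Complex.I * l)) := by
    rw [map_inv₀]
    field_simp
    linear_combination -h
  have h2 := congrArg Complex.im h1
  simp only [Complex.sub_im, Complex.conj_im, Complex.neg_im, Complex.mul_im, Complex.I_im,
    Complex.I_re, Complex.ofReal_im, Complex.ofReal_re, Complex.mul_re, Complex.re_ofNat,
    Complex.im_ofNat] at h2
  apply Complex.ext
  · simp [spectrumToLine]
  · simp only [Complex.sub_im, Complex.mul_im, Complex.I_im,
      Complex.I_re, Complex.ofReal_im, Complex.ofReal_re]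
    linarith

theorem isBoundedBorel_resolvent {w : ℂ} (hw : w.im ≠ 0) :
    IsBoundedBorel fun t => ((t : ℂ) - w)⁻¹ := by
  refine ⟨by fun_prop, |w.im|⁻¹, fun t => ?_⟩
  rw [norm_inv]
  refine inv_anti₀ (abs_pos.2 hw) ?_
  have := Complex.abs_im_le_norm ((t : ℂ) - w)
  simpa using this

theorem IsBoundedBorel.comp_measurable {X : Type*} [MeasurableSpace X] {f : ℝ → ℂ}
    (hf : IsBoundedBorel f) {k : X → ℝ} (hk : Measurable k) : IsBddMeas fun x => f (k x) :=
  ⟨hf.1.comp hk, hf.2.choose, fun x => hf.2.choose_spec (k x)⟩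

theorem exists_isBorelFunctionalCalculus {A : H →ₗ.[ℂ] H} {l : ℝ} (hl : l ≠ 0) {T : H →L[ℂ] H}
    (hT : IsResolventAt A (Complex.I * l) T)
    (hS : IsResolventAt A (-(Complex.I * l)) (star T)) :
    ∃ Φ : (ℝ → ℂ) → H →L[ℂ] H, IsBorelFunctionalCalculus A Φ ∧ ∀ φ : H, ∃ μ : Measure ℝ,
      IsFiniteMeasure μ ∧ ∀ f, IsBoundedBorel f → ∫ t, f t ∂μ = inner ℂ φ (Φ f φ) := by
  have hn := isStarNormal_of_isResolventAt hl hT hS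
  let π : C(spectrum ℂ T, ℂ) →⋆ₐ[ℂ] (H →L[ℂ] H) := cfcHom hn
  let i : C(spectrum ℂ T, ℂ) := (ContinuousMap.id ℂ).restrict (spectrum ℂ T)
  have hi : borelCalculus π i = T := (borelCalculus_continuousMap π i).trans (cfcHom_id hn)
  let k := spectrumToLine T
  have hk : Measurable k := measurable_spectrumToLine T
  let Φ : (ℝ → ℂ) → H →L[ℂ] H := fun f => borelCalculus π fun x => f (k x)
  have hb : ∀ f, IsBoundedBorel f → IsBddMeas fun x => f (k x) :=
    fun f hf => hf.comp_measurable hk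
  have hcomm : ∀ f, IsBoundedBorel f → ∀ ψ, Φ f (T ψ) = T (Φ f ψ) := by
    intro f hf ψ
    have h1 := borelCalculus_mul π (hb f hf) i.isBddMeas
    have h2 := borelCalculus_mul π i.isBddMeas (hb f hf)
    simp only [mul_comm (i _)] at h2
    rw [h1, hi] at h2
    exact congrArg (fun B : H →L[ℂ] H => B ψ) h2
  have hres : ∀ w : ℂ, w.im ≠ 0 → ∀ ψ, Φ (fun t => ((t : ℂ) - w)⁻¹) ψ
      = T (ψ - (Complex.I * l - w) • Φ (fun t => ((t : ℂ) - w)⁻¹) ψ) := by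
    intro w hw ψ
    have hg := hb _ (isBoundedBorel_resolvent hw)
    let g : spectrum ℂ T → ℂ := fun x => ((k x : ℂ) - w)⁻¹
    -- At `x = 0` the map `k` takes the meaningless value `0`, where the resolvent identity for `g`
    -- and `i` fails. The extra factor `i` hides this point, and injectivity of `T` later cancels
    -- it.
    have h1 : (fun x => i x * (g x + (Complex.I * l - w) * (i x * g x))) = fun x => i x * i x := by
      funext x
      by_cases hx : (x : ℂ) = 0
      · have : i x = 0 := hx
        simp [this]
      · have h2 : i x * ((k x : ℂ) - Complex.I * l) = 1 := mul_spectrumToLine hT hS hn x hx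
        have h3 : (k x : ℂ) - w ≠ 0 := by
          intro h
          have := congrArg Complex.im h
          simp at this
          exact hw this
        have h4 : ((k x : ℂ) - w) * g x = 1 := mul_inv_cancel₀ h3
        linear_combination (i x * i x) * h4 - i x * g x * h2
    have h2 := congrArg (borelCalculus π) h1
    rw [borelCalculus_mul π i.isBddMeas (hg.add ((isBddMeas_const _).mul (i.isBddMeas.mul hg))),
      borelCalculus_add π hg ((isBddMeas_const _).mul (i.isBddMeas.mul hg)),
      borelCalculus_smul π _ (i.isBddMeas.mul hg), borelCalculus_mul π i.isBddMeas hg,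
      borelCalculus_mul π i.isBddMeas i.isBddMeas, hi] at h2
    have h3 : T (Φ (fun t => ((t : ℂ) - w)⁻¹) ψ
        + (Complex.I * l - w) • T (Φ (fun t => ((t : ℂ) - w)⁻¹) ψ)) = T (T ψ) :=
      congrArg (fun B : H →L[ℂ] H => B ψ) h2
    rw [← sub_eq_zero, ← map_sub] at h3
    have h4 := hT.injective h3
    rw [map_sub, map_smul, eq_sub_iff_add_eq]
    exact sub_eq_zero.1 h4
  refine ⟨Φ, ?_, fun φ => ⟨(vectorMeasure π φ).map k, inferInstance, fun f hf => ?_⟩⟩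
  · refine ⟨?_, fun f g hf hg => borelCalculus_add π (hb f hf) (hb g hg),
      fun c f hf => borelCalculus_smul π c (hb f hf),
      fun f g hf hg => borelCalculus_mul π (hb f hf) (hb g hg),
      fun f hf => borelCalculus_star π (hb f hf),
      fun F f C hF hC h ψ => tendsto_borelCalculus π (fun n => (hF n).comp hk)
        (fun n x => hC n (k x)) (fun x => h (k x)) ψ, ?_, ?_⟩
    · exact (borelCalculus_continuousMap π 1).trans (map_one π)
    · intro w hw ψ
      have h1 := hres w hw ψ
      set R := Φ (fun t => ((t : ℂ) - w)⁻¹) ψ with hR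
      obtain ⟨h2, h3⟩ := hT.right (ψ - (Complex.I * l - w) • R)
      have h4 : R ∈ A.domain := h1 ▸ h2
      refine ⟨h4, ?_⟩
      have h5 : (⟨T (ψ - (Complex.I * l - w) • R), h2⟩ : A.domain) = ⟨R, h4⟩ :=
        Subtype.ext h1.symm
      rw [h5, ← h1, sub_smul] at h3
      have h6 := congrArg (fun y => y + (Complex.I * l) • R - w • R) h3
      refine Eq.trans (by abel) (h6.trans (by abel))
    · intro w hw ψ
      have h1 := hT.left ψ
      have h2 := hres w hw (A ψ - (Complex.I * l) • (ψ : H))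
      have h3 : A ψ - w • (ψ : H)
          = (A ψ - (Complex.I * l) • (ψ : H)) + (Complex.I * l - w) • (ψ : H) := by
        rw [sub_smul]; abel
      have h4 := hcomm _ (isBoundedBorel_resolvent hw) (A ψ - (Complex.I * l) • (ψ : H))
      rw [h1] at h4
      rw [h3, map_add, map_smul, h2, map_sub, map_smul, h1, ← h4]
      abel
  · rw [integral_map hk.aemeasurable hf.1.aestronglyMeasurable]
    exact integral_vectorMeasure π (hb f hf) φ

/-- Existence is all that is required: later estimates use only the defining properties of the
chosen measure, never its uniqueness. -/
theorem isSpectralMeasure_spectralMeasure {A : H →ₗ.[ℂ] H} {l : ℝ} (hl : l ≠ 0) {T : H →L[ℂ] H}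
    (hT : IsResolventAt A (Complex.I * l) T)
    (hS : IsResolventAt A (-(Complex.I * l)) (star T)) (φ : H) :
    IsSpectralMeasure A φ (spectralMeasure A φ) := by
  obtain ⟨Φ, h1, h2⟩ := exists_isBorelFunctionalCalculus hl hT hS
  obtain ⟨μ, h3, h4⟩ := h2 φ
  have h : ∃ μ : Measure ℝ, IsSpectralMeasure A φ μ := ⟨μ, h3, Φ, h1, h4⟩
  rw [spectralMeasure, dif_pos h]
  exact h.choose_spec

end Transfer

/-! ### The adjacency operator on `ℓ²(Ω)` -/

theorem memℓp_two_iff_tsum_enorm {ι : Type*} (f : ι → ℂ) :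
    Memℓp f 2 ↔ ∑' n, ‖f n‖ₑ ^ 2 ≠ ⊤ := by
  have h : ∀ n, ‖f n‖ₑ ^ 2 = ENNReal.ofReal (‖f n‖ ^ 2) := fun n => by
    rw [ENNReal.ofReal_pow (norm_nonneg _), ofReal_norm]
  rw [memℓp_gen_iff (by norm_num)]
  simp only [ENNReal.toReal_ofNat, Real.rpow_ofNat, h]
  refine ⟨fun hs => hs.tsum_ofReal_ne_top, fun hs => ?_⟩
  have := ENNReal.summable_toReal hs
  exact this.congr fun n => ENNReal.toReal_ofReal (by positivity)

theorem lp.enorm_sq_eq_tsum {ι : Type*} (f : lp (fun _ : ι => ℂ) 2) :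
    ‖f‖ₑ ^ 2 = ∑' n, ‖f n‖ₑ ^ 2 := by
  have h : ∀ n, ‖f n‖ₑ ^ 2 = ENNReal.ofReal (‖f n‖ ^ 2) := fun n => by
    rw [ENNReal.ofReal_pow (norm_nonneg _), ofReal_norm]
  have h1 := lp.hasSum_norm (p := 2) (by norm_num) f
  simp only [ENNReal.toReal_ofNat, Real.rpow_ofNat] at h1
  simp only [h]
  rw [← ENNReal.ofReal_tsum_of_nonneg (fun n => by positivity) h1.summable, h1.tsum_eq,
    ENNReal.ofReal_pow (norm_nonneg _), ofReal_norm]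

theorem mem_neighborsIn {d : ℕ} {Ω : Set (Fin d → ℤ)} {n m : Ω} :
    m ∈ neighborsIn Ω n ↔ (latticeGraph d).Adj n m := by
  simp [neighborsIn]

theorem mem_neighborsIn_comm {d : ℕ} {Ω : Set (Fin d → ℤ)} {n m : Ω} :
    m ∈ neighborsIn Ω n ↔ n ∈ neighborsIn Ω m := by
  rw [mem_neighborsIn, mem_neighborsIn, SimpleGraph.adj_comm]

/-- The degree of the lattice. -/
def latticeDegree (d : ℕ) : ℕ := (finite_setOf_latticeGraph_adj (0 : Fin d → ℤ)).toFinset.card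

theorem card_neighborsIn_le {d : ℕ} (Ω : Set (Fin d → ℤ)) (n : Ω) :
    (neighborsIn Ω n).card ≤ latticeDegree d := by
  refine Finset.card_le_card_of_injOn (fun m => (m : Fin d → ℤ) - n) (fun m hm => ?_) ?_
  · have h : (latticeGraph d).Adj n m := mem_neighborsIn.1 hm
    simp only [Set.Finite.coe_toFinset, Set.mem_ofPred_eq]
    change ∑ i, ((0 : ℤ) - ((m : Fin d → ℤ) i - (n : Fin d → ℤ) i)) ^ 2 = 1
    have h' : ∑ i, ((n : Fin d → ℤ) i - (m : Fin d → ℤ) i) ^ 2 = 1 := h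
    rw [← h']
    exact Finset.sum_congr rfl fun i _ => by ring
  · intro a _ b _ hab
    exact Subtype.ext (sub_left_injective hab)

theorem enorm_sum_sq_le {ι : Type*} (s : Finset ι) (f : ι → ℂ) :
    ‖∑ m ∈ s, f m‖ₑ ^ 2 ≤ s.card * ∑ m ∈ s, ‖f m‖ₑ ^ 2 := by
  have h1 : ‖∑ m ∈ s, f m‖₊ ≤ ∑ m ∈ s, ‖f m‖₊ := nnnorm_sum_le _ _
  have h2 : ‖∑ m ∈ s, f m‖₊ ^ 2 ≤ s.card * ∑ m ∈ s, ‖f m‖₊ ^ 2 :=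
    (pow_le_pow_left' h1 2).trans (sq_sum_le_card_mul_sum_sq)
  simp only [enorm_eq_nnnorm]
  exact_mod_cast h2

/-- Schur's test: Cauchy–Schwarz at each site costs one factor of the degree; exchanging the sums,
by symmetry of adjacency, costs the other. -/
theorem tsum_enorm_adjacency_sq_le {d : ℕ} (Ω : Set (Fin d → ℤ)) (f : Ω → ℂ) :
    ∑' n, ‖∑ m ∈ neighborsIn Ω n, f m‖ₑ ^ 2 ≤ (latticeDegree d : ℝ≥0∞) ^ 2 * ∑' n, ‖f n‖ₑ ^ 2 := by
  classical
  set N : ℝ≥0∞ := (latticeDegree d : ℝ≥0∞)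
  have h1 : ∀ n, ‖∑ m ∈ neighborsIn Ω n, f m‖ₑ ^ 2
      ≤ N * ∑' m, (if m ∈ neighborsIn Ω n then ‖f m‖ₑ ^ 2 else 0) := by
    intro n
    refine (enorm_sum_sq_le _ _).trans ?_
    rw [tsum_eq_sum (s := neighborsIn Ω n) (by simp +contextual), Finset.sum_ite_mem,
      Finset.inter_self]
    gcongr
    exact Nat.cast_le.2 (card_neighborsIn_le Ω n)
  refine (ENNReal.tsum_le_tsum h1).trans ?_
  rw [ENNReal.tsum_mul_left, ENNReal.tsum_comm, sq, mul_assoc]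
  gcongr
  rw [← ENNReal.tsum_mul_left]
  refine ENNReal.tsum_le_tsum fun m => ?_
  rw [tsum_eq_sum (s := neighborsIn Ω m) (fun n hn => if_neg fun h => hn (mem_neighborsIn_comm.1 h))]
  have h2 : ∀ n ∈ neighborsIn Ω m,
      (if m ∈ neighborsIn Ω n then ‖f m‖ₑ ^ 2 else 0) ≤ ‖f m‖ₑ ^ 2 := fun n _ => by
    split_ifs <;> simp
  refine (Finset.sum_le_card_nsmul _ _ _ h2).trans ?_
  rw [nsmul_eq_mul]
  gcongr
  exact Nat.cast_le.2 (card_neighborsIn_le Ω m)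

theorem memℓp_adjacency {d : ℕ} (Ω : Set (Fin d → ℤ)) (f : ellTwo Ω) :
    Memℓp (fun n => ∑ m ∈ neighborsIn Ω n, f m) 2 := by
  rw [memℓp_two_iff_tsum_enorm]
  refine ne_top_of_le_ne_top (ENNReal.mul_ne_top (by simp) ?_) (tsum_enorm_adjacency_sq_le Ω f)
  exact (memℓp_two_iff_tsum_enorm _).1 (lp.memℓp f)

/-- The adjacency operator of `Ω` on `ℓ²(Ω)`. -/
def adjacencyCLM {d : ℕ} (Ω : Set (Fin d → ℤ)) : ellTwo Ω →L[ℂ] ellTwo Ω :=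
  LinearMap.mkContinuous
    { toFun := fun f => ⟨fun n => ∑ m ∈ neighborsIn Ω n, f m, memℓp_adjacency Ω f⟩
      map_add' := fun f g => by
        ext n
        exact Finset.sum_add_distrib
      map_smul' := fun c f => by
        ext n
        simp [Finset.mul_sum] }
    (latticeDegree d) fun f => by
      have h := tsum_enorm_adjacency_sq_le Ω f
      rw [← lp.enorm_sq_eq_tsum] at h
      have h2 := lp.enorm_sq_eq_tsum (⟨_, memℓp_adjacency Ω f⟩ : ellTwo Ω)
      change _ = ∑' n, ‖∑ m ∈ neighborsIn Ω n, f m‖ₑ ^ 2 at h2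
      rw [← h2, ← mul_pow] at h
      have h3 := (ENNReal.pow_le_pow_left_iff two_ne_zero).1 h
      simp only [enorm_eq_nnnorm] at h3
      exact_mod_cast h3

theorem adjacencyCLM_apply {d : ℕ} (Ω : Set (Fin d → ℤ)) (f : ellTwo Ω) (n : Ω) :
    adjacencyCLM Ω f n = ∑ m ∈ neighborsIn Ω n, f m := rfl

theorem adjacencyCLM_single {d : ℕ} (Ω : Set (Fin d → ℤ)) [DecidableEq Ω] (i j : Ω) (a : ℂ) :
    adjacencyCLM Ω (lp.single 2 i a) j = if i ∈ neighborsIn Ω j then a else 0 := by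
  rw [adjacencyCLM_apply]
  simp only [lp.coeFn_single, Pi.single_apply]
  rw [Finset.sum_ite_eq']

theorem adjacencyCLM_adjoint {d : ℕ} (Ω : Set (Fin d → ℤ)) :
    ContinuousLinearMap.adjoint (adjacencyCLM Ω) = adjacencyCLM Ω := by
  classical
  refine lp.ext_continuousLinearMap (by norm_num) fun i => ?_
  ext1
  ext j
  have h1 := lp.inner_single_left (𝕜 := ℂ) j (1 : ℂ)
    (ContinuousLinearMap.adjoint (adjacencyCLM Ω) (lp.single 2 i (1 : ℂ)))
  rw [ContinuousLinearMap.adjoint_inner_right, lp.inner_single_right, adjacencyCLM_single] at h1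
  have h2 := adjacencyCLM_single Ω i j 1
  simp only [mem_neighborsIn_comm (n := j)] at h2
  change (ContinuousLinearMap.adjoint (adjacencyCLM Ω) (lp.single 2 i (1 : ℂ))) j
    = adjacencyCLM Ω (lp.single 2 i (1 : ℂ)) j
  rw [h2]
  simp only [RCLike.inner_apply, map_one, mul_one, one_mul] at h1
  rw [← h1]
  split_ifs <;> simp


/-- Multiplication by a bounded function on `ℓ²`. -/
def diagonalCLM {ι : Type*} (b : ι → ℂ) (C : ℝ) (hC : 0 ≤ C) (hb : ∀ n, ‖b n‖ ≤ C) :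
    lp (fun _ : ι => ℂ) 2 →L[ℂ] lp (fun _ : ι => ℂ) 2 :=
  have key : ∀ f : lp (fun _ : ι => ℂ) 2, ∀ n, ‖b n * f n‖ ≤ ‖((C : ℂ) • f) n‖ := fun f n => by
    rw [lp.coeFn_smul, Pi.smul_apply, smul_eq_mul, norm_mul, norm_mul, Complex.norm_real,
      Real.norm_of_nonneg hC]
    exact mul_le_mul_of_nonneg_right (hb n) (norm_nonneg _)
  have hm : ∀ f : lp (fun _ : ι => ℂ) 2, Memℓp (fun n => b n * f n) 2 := fun f =>
    (lp.memℓp ((C : ℂ) • f)).mono' (key f)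
  LinearMap.mkContinuous
    { toFun := fun f => ⟨fun n => b n * f n, hm f⟩
      map_add' := fun f g => by
        ext n
        exact mul_add _ _ _
      map_smul' := fun c f => by
        ext n
        exact mul_left_comm _ _ _ }
    C fun f => by
      have h : ‖(C : ℂ) • f‖ = C * ‖f‖ := by
        rw [norm_smul, Complex.norm_real, Real.norm_of_nonneg hC]
      rw [← h]
      exact lp.norm_mono (by norm_num) (key f)

theorem norm_diagonalCLM_le {ι : Type*} (b : ι → ℂ) (C : ℝ) (hC : 0 ≤ C)
    (hb : ∀ n, ‖b n‖ ≤ C) : ‖diagonalCLM b C hC hb‖ ≤ C := by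
  unfold diagonalCLM
  exact LinearMap.mkContinuous_norm_le _ hC _

/-! ### Symmetry and resolvents of the Schrödinger operator -/

theorem schrodingerOp_apply {d : ℕ} (Ω : Set (Fin d → ℤ)) (v : Ω → ℝ)
    (f : (schrodingerOp Ω v).domain) (n : Ω) :
    schrodingerOp Ω v f n = adjacencyCLM Ω f n + (v n : ℂ) * (f : ellTwo Ω) n := rfl

theorem mem_schrodingerOp_domain {d : ℕ} {Ω : Set (Fin d → ℤ)} {v : Ω → ℝ} {f : ellTwo Ω} :
    f ∈ (schrodingerOp Ω v).domain ↔ Memℓp (schrodingerExpr Ω v (f : Ω → ℂ)) 2 := Iff.rfl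

theorem schrodingerOp_symmetric {d : ℕ} (Ω : Set (Fin d → ℤ)) (v : Ω → ℝ)
    (f g : (schrodingerOp Ω v).domain) :
    inner ℂ (schrodingerOp Ω v f) (g : ellTwo Ω) = inner ℂ (f : ellTwo Ω) (schrodingerOp Ω v g) := by
  have h1 : inner ℂ (adjacencyCLM Ω f) (g : ellTwo Ω) = inner ℂ (f : ellTwo Ω) (adjacencyCLM Ω g) := by
    rw [← ContinuousLinearMap.adjoint_inner_right, adjacencyCLM_adjoint]
  have h2 : inner ℂ (schrodingerOp Ω v f - adjacencyCLM Ω f) (g : ellTwo Ω)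
      = inner ℂ (f : ellTwo Ω) (schrodingerOp Ω v g - adjacencyCLM Ω g) := by
    rw [lp.inner_eq_tsum, lp.inner_eq_tsum]
    refine tsum_congr fun n => ?_
    rw [lp.coeFn_sub, lp.coeFn_sub, Pi.sub_apply, Pi.sub_apply, schrodingerOp_apply,
      schrodingerOp_apply, add_sub_cancel_left, add_sub_cancel_left]
    simp only [RCLike.inner_apply, map_mul, Complex.conj_ofReal]
    ring
  rw [inner_sub_left, inner_sub_right, h1] at h2
  exact sub_left_injective h2

/-- With `D` the adjacency operator and `G = (v - z)⁻¹`, formally `(h - z)G = 1 + DG`. As `‖G‖ ≤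
1/|Im z|`, a Neumann series inverts the right side, and the resolvent is `G(1 + DG)⁻¹`, however
unbounded `v` is. -/
theorem exists_isResolventAt_schrodingerOp {d : ℕ} (Ω : Set (Fin d → ℤ)) (v : Ω → ℝ) {z : ℂ}
    (hz : ‖adjacencyCLM Ω‖ < |z.im|) : ∃ T, IsResolventAt (schrodingerOp Ω v) z T := by
  have hpos : 0 < |z.im| := (norm_nonneg _).trans_lt hz
  have him : ∀ n, |z.im| ≤ ‖(v n : ℂ) - z‖ := fun n => by
    simpa using Complex.abs_im_le_norm ((v n : ℂ) - z)
  have hne : ∀ n, (v n : ℂ) - z ≠ 0 := fun n => norm_pos_iff.1 (hpos.trans_le (him n))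
  have hb : ∀ n, ‖((v n : ℂ) - z)⁻¹‖ ≤ |z.im|⁻¹ := fun n => by
    rw [norm_inv]
    exact inv_anti₀ hpos (him n)
  let G := diagonalCLM (fun n => ((v n : ℂ) - z)⁻¹) |z.im|⁻¹ (by positivity) hb
  have hG : ∀ f n, G f n = ((v n : ℂ) - z)⁻¹ * f n := fun f n => rfl
  have hlt : ‖-(adjacencyCLM Ω * G)‖ < 1 := by
    rw [norm_neg]
    refine (norm_mul_le _ _).trans_lt ?_
    refine (mul_le_mul_of_nonneg_left (norm_diagonalCLM_le _ _ _ hb) (norm_nonneg _)).trans_lt ?_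
    rw [← div_eq_mul_inv, div_lt_one hpos]
    exact hz
  let U := Units.oneSub (-(adjacencyCLM Ω * G)) hlt
  have hU : ∀ f, (U : ellTwo Ω →L[ℂ] ellTwo Ω) f = f + adjacencyCLM Ω (G f) := fun f => by
    rw [Units.val_oneSub, sub_neg_eq_add]
    rfl
  let W : ellTwo Ω →L[ℂ] ellTwo Ω := ↑U⁻¹
  have hUW : ∀ f, W f + adjacencyCLM Ω (G (W f)) = f := fun f => by
    rw [← hU, ← mul_apply_eq_comp, Units.mul_inv]
    rfl
  have hWU : ∀ f, W (f + adjacencyCLM Ω (G f)) = f := fun f => by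
    rw [← hU, ← mul_apply_eq_comp, Units.inv_mul]
    rfl
  refine ⟨G * W, ⟨fun ψ => ?_, fun f => ?_⟩⟩
  · have hvG : ∀ n, (v n : ℂ) * G (W ψ) n = W ψ n + z * G (W ψ) n := fun n => by
      rw [hG]
      have := hne n
      field_simp
      ring
    have hexpr : schrodingerExpr Ω v (G (W ψ) : ellTwo Ω) = ((ψ + z • G (W ψ) : ellTwo Ω) : Ω → ℂ) := by
      funext n
      change adjacencyCLM Ω (G (W ψ)) n + (v n : ℂ) * G (W ψ) n = _
      rw [hvG, lp.coeFn_add, Pi.add_apply, lp.coeFn_smul, Pi.smul_apply, smul_eq_mul]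
      nth_rewrite 4 [← hUW ψ]
      rw [lp.coeFn_add, Pi.add_apply]
      ring
    refine ⟨?_, ?_⟩
    · refine mem_schrodingerOp_domain.2 ?_
      change Memℓp (schrodingerExpr Ω v (G (W ψ) : ellTwo Ω)) 2
      rw [hexpr]
      exact lp.memℓp _
    · rw [sub_eq_iff_eq_add]
      ext n
      exact congrFun hexpr n
  -- This is `(v - z)f`, written as a difference so that it visibly lies in `ℓ²`.
  · let χ : ellTwo Ω := schrodingerOp Ω v f - z • (f : ellTwo Ω) - adjacencyCLM Ω f
    have hGχ : G χ = f := by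
      ext n
      rw [hG, lp.coeFn_sub, Pi.sub_apply, lp.coeFn_sub, Pi.sub_apply, schrodingerOp_apply,
        lp.coeFn_smul, Pi.smul_apply, smul_eq_mul]
      have := hne n
      field_simp
      ring
    have h : schrodingerOp Ω v f - z • (f : ellTwo Ω) = χ + adjacencyCLM Ω (G χ) := by
      rw [hGχ, sub_add_cancel]
    rw [h, mul_apply_eq_comp, hWU, hGχ]

theorem star_eq_of_isResolventAt_schrodingerOp {d : ℕ} {Ω : Set (Fin d → ℤ)} {v : Ω → ℝ} {z w : ℂ}
    {T S : ellTwo Ω →L[ℂ] ellTwo Ω} (hT : IsResolventAt (schrodingerOp Ω v) z T)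
    (hS : IsResolventAt (schrodingerOp Ω v) w S) (hzw : w = (starRingEnd ℂ) z) : star T = S := by
  rw [ContinuousLinearMap.star_eq_adjoint, eq_comm, ContinuousLinearMap.eq_adjoint_iff]
  intro x y
  obtain ⟨h1, h2⟩ := hS.right x
  obtain ⟨h3, h4⟩ := hT.right y
  nth_rewrite 1 [← h4]
  nth_rewrite 2 [← h2]
  have h5 := schrodingerOp_symmetric Ω v ⟨S x, h1⟩ ⟨T y, h3⟩
  rw [inner_sub_right, inner_sub_left, h5, inner_smul_left, inner_smul_right, hzw,
    Complex.conj_conj]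

theorem isSpectralMeasure_schrodingerOp {d : ℕ} (Ω : Set (Fin d → ℤ)) (v : Ω → ℝ)
    (φ : ellTwo Ω) :
    IsSpectralMeasure (schrodingerOp Ω v) φ (spectralMeasure (schrodingerOp Ω v) φ) := by
  let l : ℝ := ‖adjacencyCLM Ω‖ + 1
  have hl : 0 < l := by positivity
  obtain ⟨T, hT⟩ := exists_isResolventAt_schrodingerOp Ω v (z := Complex.I * l) (by
    simp [abs_of_pos hl, l])
  obtain ⟨S, hS⟩ := exists_isResolventAt_schrodingerOp Ω v (z := -(Complex.I * l)) (by
    rw [Complex.neg_im, abs_neg]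
    simp [abs_of_pos hl, l])
  have h := star_eq_of_isResolventAt_schrodingerOp hT hS (by simp)
  exact isSpectralMeasure_spectralMeasure hl.ne' hT (h ▸ hS) φ

/-! ### Resolvent bounds from the local behaviour of the spectral measure -/

/-- A dyadic decomposition bounds the Poisson-type integral by the mass of dyadic intervals. -/
theorem lintegral_inv_sq_add_sq_le {μ : Measure ℝ} {E ε : ℝ} (hε : 0 < ε) {B : ℝ≥0∞}
    (h : ∀ k : ℕ, μ (Set.Ioo (E - 2 ^ k * ε) (E + 2 ^ k * ε)) ≤ B * 3 ^ k) :
    ∫⁻ t, ENNReal.ofReal (((t - E) ^ 2 + ε ^ 2)⁻¹) ∂μ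
      ≤ ENNReal.ofReal (16 * (ε ^ 2)⁻¹) * B := by
  classical
  -- Outside radius `2^(k-1) ε` the kernel is at most `4ε⁻² 4⁻ᵏ`; against mass `3ᵏ B` this sums to
  -- `4ε⁻² B ∑ (3/4)ᵏ = 16ε⁻² B`.
  let a : ℕ → ℝ≥0∞ := fun k => ENNReal.ofReal (4 * (ε ^ 2)⁻¹) * (ENNReal.ofReal (1 / 4)) ^ k
  let I : ℕ → Set ℝ := fun k => Set.Ioo (E - 2 ^ k * ε) (E + 2 ^ k * ε)
  have hpt : ∀ t, ENNReal.ofReal (((t - E) ^ 2 + ε ^ 2)⁻¹)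
      ≤ ∑' k, (I k).indicator (fun _ => a k) t := by
    intro t
    have hex : ∃ k : ℕ, |t - E| < 2 ^ k * ε := by
      obtain ⟨k, hk⟩ := pow_unbounded_of_one_lt (|t - E| / ε) one_lt_two
      exact ⟨k, (div_lt_iff₀ hε).1 hk⟩
    refine le_trans ?_ (ENNReal.le_tsum (Nat.find hex))
    have hk := Nat.find_spec hex
    have hmin := fun j => Nat.find_min hex (m := j)
    set k := Nat.find hex
    have hmem : t ∈ I k := by
      have := abs_lt.1 hk
      exact ⟨by linarith [this.1], by linarith [this.2]⟩
    rw [Set.indicator_of_mem hmem]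
    simp only [a]
    rw [← ENNReal.ofReal_pow (by norm_num), ← ENNReal.ofReal_mul (by positivity)]
    refine ENNReal.ofReal_le_ofReal ?_
    rcases Nat.eq_zero_or_pos k with h0 | h0
    · rw [h0, pow_zero, mul_one]
      have h1 : ((t - E) ^ 2 + ε ^ 2)⁻¹ ≤ (ε ^ 2)⁻¹ :=
        inv_anti₀ (by positivity) (by nlinarith [sq_nonneg (t - E)])
      have h2 : 0 ≤ (ε ^ 2)⁻¹ := by positivity
      linarith
    · have h1 := not_lt.1 (hmin (k - 1) (by omega))
      have h2 : ((2 : ℝ) ^ (k - 1) * ε) ^ 2 ≤ (t - E) ^ 2 := by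
        rw [← sq_abs (t - E)]
        exact pow_le_pow_left₀ (by positivity) h1 2
      have h3 : 4 * (ε ^ 2)⁻¹ * (1 / 4) ^ k = (((2 : ℝ) ^ (k - 1) * ε) ^ 2)⁻¹ := by
        obtain ⟨j, hj⟩ : ∃ j, k = j + 1 := ⟨k - 1, by omega⟩
        have h5 : (1 / 4 : ℝ) ^ j = ((2 ^ 2 : ℝ) ^ j)⁻¹ := by rw [← inv_pow]; norm_num
        rw [hj, Nat.add_sub_cancel, mul_pow, ← pow_mul, mul_comm j, pow_mul, mul_inv, pow_succ (1 / 4 : ℝ), h5]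
        ring
      rw [h3]
      exact inv_anti₀ (by positivity) (by nlinarith [sq_nonneg ε])
  calc ∫⁻ t, ENNReal.ofReal (((t - E) ^ 2 + ε ^ 2)⁻¹) ∂μ
      ≤ ∫⁻ t, ∑' k, (I k).indicator (fun _ => a k) t ∂μ := lintegral_mono hpt
    _ = ∑' k, a k * μ (I k) := by
        rw [lintegral_tsum fun k => (measurable_const.indicator measurableSet_Ioo).aemeasurable]
        exact tsum_congr fun k => lintegral_indicator_const measurableSet_Ioo _
    _ ≤ ∑' k, ENNReal.ofReal (4 * (ε ^ 2)⁻¹) * B * ENNReal.ofReal (3 / 4) ^ k := by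
        refine ENNReal.tsum_le_tsum fun k => (mul_le_mul_right (h k) _).trans (le_of_eq ?_)
        have : ENNReal.ofReal (3 / 4) = ENNReal.ofReal (1 / 4) * 3 := by
          rw [← ENNReal.ofReal_ofNat, ← ENNReal.ofReal_mul (by norm_num)]
          norm_num
        rw [this, mul_pow]
        simp only [a]
        ring
    _ = ENNReal.ofReal (16 * (ε ^ 2)⁻¹) * B := by
        rw [ENNReal.tsum_mul_left, ENNReal.tsum_geometric, ← ENNReal.ofReal_one,
          ← ENNReal.ofReal_sub _ (by norm_num), ← ENNReal.ofReal_inv_of_pos (by norm_num),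
          mul_right_comm, ← ENNReal.ofReal_mul (by positivity)]
        congr 2
        norm_num
        ring

/-- The `η` term covers short intervals, the `c` term the long ones, where only the total mass is
known. The exponent `3/2` exceeds `α`, making the second term negligible as `ε → 0`, yet is below
`2`: `2^(3/2) < 3 < 4` keeps the dyadic sum convergent. -/
theorem measure_dyadic_le_of_upperDeriv_eq_zero {μ : Measure ℝ} [IsFiniteMeasure μ] {E α : ℝ}
    (hα1 : α ≤ 1) (h : upperDeriv α μ E = 0) {η : ℝ} (hη : 0 < η) :
    ∃ c : ℝ, 0 ≤ c ∧ ∀ ε, 0 < ε → ∀ k : ℕ, μ (Set.Ioo (E - 2 ^ k * ε) (E + 2 ^ k * ε))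
      ≤ ENNReal.ofReal (η * ε ^ α + c * ε ^ (3 / 2 : ℝ)) * 3 ^ k := by
  have h1 : ∀ᶠ δ in 𝓝[>] (0 : ℝ),
      μ (Set.Ioo (E - δ) (E + δ)) / ENNReal.ofReal (δ ^ α) < ENNReal.ofReal η :=
    eventually_lt_of_limsup_lt (by
      rw [upperDeriv] at h
      rw [h]
      exact ENNReal.ofReal_pos.2 hη)
  obtain ⟨δ₀, hδ₀, h2⟩ := mem_nhdsGT_iff_exists_Ioo_subset.1 h1
  have hδ₀ : 0 < δ₀ := hδ₀
  set M := (μ Set.univ).toReal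
  have hM : 0 ≤ M := ENNReal.toReal_nonneg
  refine ⟨M * (δ₀ ^ (3 / 2 : ℝ))⁻¹, by positivity, fun ε hε k => ?_⟩
  set δ := 2 ^ k * ε with hδ
  have hδpos : 0 < δ := by positivity
  have h3 : (3 : ℝ≥0∞) ^ k = ENNReal.ofReal (3 ^ k) := by
    rw [ENNReal.ofReal_pow (by norm_num), ENNReal.ofReal_ofNat]
  rw [h3, ← ENNReal.ofReal_mul (by positivity)]
  rcases lt_or_ge δ δ₀ with hlt | hge
  · have h4 := h2 ⟨hδpos, hlt⟩
    have h5 : μ (Set.Ioo (E - δ) (E + δ)) ≤ ENNReal.ofReal η * ENNReal.ofReal (δ ^ α) :=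
      (ENNReal.div_le_iff (ENNReal.ofReal_pos.2 (by positivity)).ne' ENNReal.ofReal_ne_top).1
        (le_of_lt h4)
    refine h5.trans ?_
    rw [← ENNReal.ofReal_mul hη.le]
    refine ENNReal.ofReal_le_ofReal ?_
    have h6 : δ ^ α ≤ 3 ^ k * ε ^ α := by
      rw [hδ, Real.mul_rpow (by positivity) hε.le]
      gcongr
      calc ((2 : ℝ) ^ k) ^ α ≤ ((2 : ℝ) ^ k) ^ (1 : ℝ) :=
            Real.rpow_le_rpow_of_exponent_le (one_le_pow₀ one_le_two) hα1
        _ = 2 ^ k := Real.rpow_one _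
        _ ≤ 3 ^ k := by gcongr; norm_num
    have h7 : 0 ≤ M * (δ₀ ^ (3 / 2 : ℝ))⁻¹ * ε ^ (3 / 2 : ℝ) * 3 ^ k := by positivity
    nlinarith [mul_le_mul_of_nonneg_left h6 hη.le]
  · have h4 : μ (Set.Ioo (E - δ) (E + δ)) ≤ ENNReal.ofReal M := by
      rw [ENNReal.ofReal_toReal (measure_ne_top _ _)]
      exact measure_mono (Set.subset_univ _)
    refine h4.trans (ENNReal.ofReal_le_ofReal ?_)
    have h5 : δ₀ ^ (3 / 2 : ℝ) ≤ 3 ^ k * ε ^ (3 / 2 : ℝ) := by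
      refine (Real.rpow_le_rpow hδ₀.le hge (by norm_num)).trans ?_
      rw [hδ, Real.mul_rpow (by positivity) hε.le]
      gcongr
      rw [← Real.rpow_natCast, ← Real.rpow_mul (by norm_num), mul_comm, Real.rpow_mul (by norm_num),
        Real.rpow_natCast]
      gcongr
      have : ((2 : ℝ) ^ (3 / 2 : ℝ)) ^ 2 = 8 := by
        rw [← Real.rpow_natCast, ← Real.rpow_mul (by norm_num)]
        norm_num
      nlinarith [Real.rpow_nonneg (zero_le_two (α := ℝ)) (3 / 2)]
    have h6 : 0 < δ₀ ^ (3 / 2 : ℝ) := by positivity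
    have h7 : M ≤ M * ((δ₀ ^ (3 / 2 : ℝ))⁻¹ * (3 ^ k * ε ^ (3 / 2 : ℝ))) := by
      refine le_mul_of_one_le_right hM ?_
      rw [← div_eq_inv_mul, one_le_div h6]
      exact h5
    have h8 : 0 ≤ η * ε ^ α * 3 ^ k := by positivity
    nlinarith

/-- With `r(t) = (t - z)⁻¹` and `ξ = (A - z)w`, one has `(w, φ) = (ξ, r(A)*φ)` and `‖r(A)*φ‖² = ∫
|r|² dμ`. -/
theorem norm_inner_sq_le_of_isSpectralMeasure {H : Type*} [NormedAddCommGroup H]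
    [InnerProductSpace ℂ H] [CompleteSpace H] {A : H →ₗ.[ℂ] H} {φ : H} {μ : Measure ℝ}
    (hμ : IsSpectralMeasure A φ μ) (w : A.domain) {E ε : ℝ} (hε : 0 < ε) {J : ℝ} (hJ : 0 ≤ J)
    (h : ∫⁻ t, ENNReal.ofReal (((t - E) ^ 2 + ε ^ 2)⁻¹) ∂μ ≤ ENNReal.ofReal J) :
    ‖inner ℂ (w : H) φ‖ ^ 2 ≤ ‖A w - ((E : ℂ) + ε * Complex.I) • (w : H)‖ ^ 2 * J := by
  obtain ⟨hfin, Φ, hΦ, hint⟩ := hμ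
  set z : ℂ := (E : ℂ) + ε * Complex.I with hz
  have him : z.im ≠ 0 := by simpa [hz] using hε.ne'
  set r : ℝ → ℂ := fun t => ((t : ℂ) - z)⁻¹ with hr
  have hrb : IsBoundedBorel r := isBoundedBorel_resolvent him
  have hrs : IsBoundedBorel fun t => (starRingEnd ℂ) (r t) := IsBddMeas.star hrb
  set ξ := A w - z • (w : H)
  have h1 : Φ r ξ = w := hΦ.resolvent_left z him w
  have h2 : inner ℂ (w : H) φ = inner ℂ ξ (ContinuousLinearMap.adjoint (Φ r) φ) := by
    rw [ContinuousLinearMap.adjoint_inner_right, h1]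
  have h3 : ((‖ContinuousLinearMap.adjoint (Φ r) φ‖ ^ 2 : ℝ) : ℂ)
      = ((∫ t, ((t - E) ^ 2 + ε ^ 2)⁻¹ ∂μ : ℝ) : ℂ) := by
    have h4 := hint _ (IsBddMeas.mul hrb hrs)
    rw [hΦ.map_mul _ _ hrb hrs, hΦ.map_star _ hrb, mul_apply_eq_comp,
      ← ContinuousLinearMap.adjoint_inner_left, inner_self_eq_norm_sq_to_K] at h4
    have h5 : ((∫ t, ((t - E) ^ 2 + ε ^ 2)⁻¹ ∂μ : ℝ) : ℂ)
        = ∫ t, ((((t - E) ^ 2 + ε ^ 2)⁻¹ : ℝ) : ℂ) ∂μ := integral_ofReal.symm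
    rw [h5, Complex.ofReal_pow]
    refine h4.symm.trans (integral_congr_ae (ae_of_all _ fun t => ?_))
    change r t * (starRingEnd ℂ) (r t) = _
    rw [Complex.mul_conj, hr, Complex.normSq_inv]
    simp [Complex.normSq_apply, hz, sq]
  have h4 : ‖ContinuousLinearMap.adjoint (Φ r) φ‖ ^ 2 ≤ J := by
    rw [Complex.ofReal_injective h3, integral_eq_lintegral_of_nonneg_ae
      (ae_of_all _ fun t => by positivity)
      (by fun_prop : Measurable fun t => ((t - E) ^ 2 + ε ^ 2)⁻¹).aestronglyMeasurable]
    exact ENNReal.toReal_le_of_le_ofReal hJ h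
  rw [h2]
  calc ‖inner ℂ ξ (ContinuousLinearMap.adjoint (Φ r) φ)‖ ^ 2
      ≤ (‖ξ‖ * ‖ContinuousLinearMap.adjoint (Φ r) φ‖) ^ 2 := by
        gcongr
        exact norm_inner_le_norm _ _
    _ = ‖ξ‖ ^ 2 * ‖ContinuousLinearMap.adjoint (Φ r) φ‖ ^ 2 := mul_pow _ _ _
    _ ≤ ‖ξ‖ ^ 2 * J := by gcongr

/-! ### Cut-off generalized eigenfunctions -/

theorem mem_cube_iff_norm_le {d : ℕ} {R : ℝ} (hR : 0 ≤ R) (n : Fin d → ℤ) :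
    n ∈ cube d R ↔ ‖n‖ ≤ R := by
  rw [pi_norm_le_iff_of_nonneg hR]
  simp only [cube, Set.mem_ofPred_eq, Int.norm_eq_abs]

theorem norm_sub_le_one_of_adj {d : ℕ} {n m : Fin d → ℤ} (h : (latticeGraph d).Adj n m) :
    ‖n - m‖ ≤ 1 := by
  rw [pi_norm_le_iff_of_nonneg zero_le_one]
  intro i
  have h1 : ∑ i, (n i - m i) ^ 2 = 1 := h
  have h2 : (n i - m i) ^ 2 ≤ 1 := by
    rw [← h1]
    exact Finset.single_le_sum (f := fun i => (n i - m i) ^ 2) (fun j _ => sq_nonneg _)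
      (Finset.mem_univ i)
  rw [Pi.sub_apply, Int.norm_eq_abs]
  exact_mod_cast (sq_le_one_iff_abs_le_one _).1 h2

/-- A piecewise linear cutoff, supported strictly inside the cube `C_R`. -/
def cutoff {d : ℕ} (R : ℝ) (n : Fin d → ℤ) : ℝ := max 0 (1 - (‖n‖ + 1) / R)

theorem cutoff_nonneg {d : ℕ} (R : ℝ) (n : Fin d → ℤ) : 0 ≤ cutoff R n := le_max_left _ _

theorem cutoff_le_one {d : ℕ} {R : ℝ} (hR : 0 < R) (n : Fin d → ℤ) : cutoff R n ≤ 1 := by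
  refine max_le zero_le_one ?_
  have : 0 ≤ (‖n‖ + 1) / R := by positivity
  linarith

theorem cutoff_eq_zero {d : ℕ} {R : ℝ} (hR : 0 < R) {n : Fin d → ℤ} (h : R ≤ ‖n‖ + 1) :
    cutoff R n = 0 := by
  refine max_eq_left ?_
  rw [sub_nonpos, one_le_div hR]
  exact h

theorem tendsto_cutoff {d : ℕ} (n : Fin d → ℤ) :
    Tendsto (fun R => cutoff R n) atTop (𝓝 1) := by
  have h : Tendsto (fun R : ℝ => max 0 (1 - (‖n‖ + 1) / R)) atTop (𝓝 (max 0 (1 - 0))) :=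
    tendsto_const_nhds.max (tendsto_const_nhds.sub (tendsto_id.const_div_atTop _))
  simpa [cutoff] using h

theorem abs_cutoff_sub_le {d : ℕ} {R : ℝ} (hR : 0 < R) {n m : Fin d → ℤ}
    (h : (latticeGraph d).Adj n m) : |cutoff R m - cutoff R n| ≤ R⁻¹ := by
  have h1 : |cutoff R m - cutoff R n| ≤ |(1 - (‖m‖ + 1) / R) - (1 - (‖n‖ + 1) / R)| := by
    simpa [cutoff] using abs_max_sub_max_le_max (0 : ℝ) (1 - (‖m‖ + 1) / R) 0 (1 - (‖n‖ + 1) / R)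
  refine h1.trans ?_
  have h2 : (1 - (‖m‖ + 1) / R) - (1 - (‖n‖ + 1) / R) = (‖n‖ - ‖m‖) * R⁻¹ := by ring
  rw [h2, abs_mul, abs_of_pos (inv_pos.2 hR)]
  exact mul_le_of_le_one_left (inv_pos.2 hR).le
    ((abs_norm_sub_norm_le n m).trans (norm_sub_le_one_of_adj h))

/-- The `+ 1` in `cutoff` makes it vanish already for `‖n‖ ≥ R - 1`. If `m` is outside `C_R`, both
cutoff values are therefore zero, so the commutator sees `u` only inside `C_R`. -/
theorem norm_cutoff_sub_mul_le {d : ℕ} {R : ℝ} (hR : 0 < R) {n m : Fin d → ℤ}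
    (h : (latticeGraph d).Adj n m) (a : ℂ) :
    ‖((cutoff R m - cutoff R n : ℝ) : ℂ) * a‖ ≤ R⁻¹ * (if ‖m‖ ≤ R then ‖a‖ else 0) := by
  rw [norm_mul, Complex.norm_real, Real.norm_eq_abs]
  split_ifs with hm
  · exact mul_le_mul_of_nonneg_right (abs_cutoff_sub_le hR h) (norm_nonneg _)
  · have h1 : R < ‖m‖ := not_le.1 hm
    have h2 : ‖m‖ - ‖n‖ ≤ 1 := by
      have := (abs_norm_sub_norm_le n m).trans (norm_sub_le_one_of_adj h)
      linarith [(abs_le.1 this).1]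
    rw [cutoff_eq_zero hR (by linarith : R ≤ ‖m‖ + 1), cutoff_eq_zero hR (by linarith : R ≤ ‖n‖ + 1)]
    simp

/-- The commutator contributes `‖adjacencyCLM Ω‖` and the shift by `i/R` contributes `1`. The
conjugate of `u` is used because the inner product is conjugate-linear in its first slot; it solves
the same equation since `v` and `E` are real. -/
theorem exists_cutoff_solution {d : ℕ} (Ω : Set (Fin d → ℤ)) (v : Ω → ℝ)
    (E : ℝ) (u : Ω → ℂ) (hu : schrodingerExpr Ω v u = (E : ℂ) • u) {R S : ℝ} (hR : 0 < R)
    (hS0 : 0 ≤ S)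
    (hS : ∑' n : {n : Ω // (n : Fin d → ℤ) ∈ cube d R}, ‖u n‖ₑ ^ 2 ≤ ENNReal.ofReal S) :
    ∃ w : (schrodingerOp Ω v).domain,
      (∀ n, (w : ellTwo Ω) n = (cutoff R (n : Fin d → ℤ) : ℂ) * (starRingEnd ℂ) (u n)) ∧
      ‖schrodingerOp Ω v w - ((E : ℂ) + (R⁻¹ : ℝ) * Complex.I) • (w : ellTwo Ω)‖ ^ 2
        ≤ (R⁻¹ * (‖adjacencyCLM Ω‖ + 1)) ^ 2 * S := by
  classical
  -- Replacing `u` by `|u|` on the cube gives a nonnegative majorant, to which the operator norm of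
  -- the adjacency operator can be applied.
  let g₀ : Ω → ℂ := fun n => ((if ‖(n : Fin d → ℤ)‖ ≤ R then ‖u n‖ else 0 : ℝ) : ℂ)
  have hg₀ : ∑' n, ‖g₀ n‖ₑ ^ 2 ≤ ENNReal.ofReal S := by
    refine le_trans (le_of_eq ?_) hS
    refine Eq.trans ?_ (tsum_subtype {n : Ω | (n : Fin d → ℤ) ∈ cube d R} (fun n => ‖u n‖ₑ ^ 2)).symm
    refine tsum_congr fun n => ?_
    simp only [g₀, Set.indicator_apply, Set.mem_ofPred_eq, mem_cube_iff_norm_le hR.le]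
    split_ifs
    · rw [← ofReal_norm, Complex.norm_real, norm_norm, ofReal_norm]
    · simp
  let g : ellTwo Ω := ⟨g₀, (memℓp_two_iff_tsum_enorm _).2 (ne_top_of_le_ne_top ENNReal.ofReal_ne_top hg₀)⟩
  have hg : ∀ n, g n = g₀ n := fun n => rfl
  have hgS : ‖g‖ ^ 2 ≤ S := by
    have h1 := lp.enorm_sq_eq_tsum g
    rw [← h1, ← ofReal_norm, ← ENNReal.ofReal_pow (norm_nonneg _)] at hg₀
    exact (ENNReal.ofReal_le_ofReal_iff hS0).1 hg₀
  let w₀ : Ω → ℂ := fun n => (cutoff R (n : Fin d → ℤ) : ℂ) * (starRingEnd ℂ) (u n)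
  have hw₀g : ∀ n, ‖w₀ n‖ ≤ ‖g n‖ := by
    intro n
    simp only [w₀, hg, g₀, norm_mul, Complex.norm_real, RCLike.norm_conj, Real.norm_of_nonneg (cutoff_nonneg _ _)]
    split_ifs with h
    · rw [norm_norm]
      exact mul_le_of_le_one_left (norm_nonneg _) (cutoff_le_one hR _)
    · rw [cutoff_eq_zero hR (by linarith [not_le.1 h])]
      simp
  have hw₀ : Memℓp w₀ 2 := (lp.memℓp g).mono' hw₀g
  let w : ellTwo Ω := ⟨w₀, hw₀⟩
  set z : ℂ := (E : ℂ) + (R⁻¹ : ℝ) * Complex.I with hz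
  have hexpr : ∀ n, schrodingerExpr Ω v w₀ n - z * w₀ n
      = ∑ m ∈ neighborsIn Ω n, ((cutoff R (m : Fin d → ℤ) - cutoff R (n : Fin d → ℤ) : ℝ) : ℂ)
          * (starRingEnd ℂ) (u m) - (R⁻¹ : ℝ) * Complex.I * w₀ n := by
    intro n
    have h1 : ∑ m ∈ neighborsIn Ω n, u m + (v n : ℂ) * u n = (E : ℂ) * u n := congrFun hu n
    have h2 := congrArg (starRingEnd ℂ) h1
    simp only [map_add, map_mul, map_sum, Complex.conj_ofReal] at h2
    change ∑ m ∈ neighborsIn Ω n, w₀ m + (v n : ℂ) * w₀ n - z * w₀ n = _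
    simp only [Complex.ofReal_sub, sub_mul, Finset.sum_sub_distrib, ← Finset.mul_sum]
    simp only [w₀, hz]
    linear_combination (cutoff R (n : Fin d → ℤ) : ℂ) * h2
  let G : ellTwo Ω := ((R⁻¹ : ℝ) : ℂ) • (adjacencyCLM Ω g + g)
  have hG : ∀ n, ‖schrodingerExpr Ω v w₀ n - z * w₀ n‖ ≤ ‖G n‖ := by
    intro n
    have h1 : G n = ((R⁻¹ * (∑ m ∈ neighborsIn Ω n,
        (if ‖(m : Fin d → ℤ)‖ ≤ R then ‖u m‖ else 0)
          + (if ‖(n : Fin d → ℤ)‖ ≤ R then ‖u n‖ else 0)) : ℝ) : ℂ) := by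
      rw [Complex.ofReal_mul, Complex.ofReal_add, Complex.ofReal_sum]
      rfl
    have h2 : ∀ m : Ω, 0 ≤ (if ‖(m : Fin d → ℤ)‖ ≤ R then ‖u m‖ else 0) := fun m => by
      split_ifs <;> positivity
    have h3 : 0 ≤ ∑ m ∈ neighborsIn Ω n, (if ‖(m : Fin d → ℤ)‖ ≤ R then ‖u m‖ else 0) :=
      Finset.sum_nonneg fun m _ => h2 m
    rw [h1, Complex.norm_real, Real.norm_of_nonneg
      (mul_nonneg (inv_pos.2 hR).le (add_nonneg h3 (h2 n))), hexpr, mul_add, Finset.mul_sum]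
    refine (norm_sub_le _ _).trans (add_le_add ((norm_sum_le _ _).trans
      (Finset.sum_le_sum fun m hm => ?_)) ?_)
    · have := norm_cutoff_sub_mul_le hR (mem_neighborsIn.1 hm) ((starRingEnd ℂ) (u m))
      rwa [RCLike.norm_conj] at this
    · rw [norm_mul, norm_mul, Complex.norm_real, Complex.norm_I, mul_one,
        Real.norm_of_nonneg (inv_pos.2 hR).le]
      refine mul_le_mul_of_nonneg_left ((hw₀g n).trans (le_of_eq ?_)) (inv_pos.2 hR).le
      rw [hg, Complex.norm_real, Real.norm_of_nonneg (h2 n)]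
  have hmem : w ∈ (schrodingerOp Ω v).domain := by
    refine mem_schrodingerOp_domain.2 ?_
    have h1 : Memℓp (fun n => schrodingerExpr Ω v w₀ n - z * w₀ n) 2 :=
      (lp.memℓp G).mono' hG
    have h2 := h1.add (hw₀.const_mul z)
    convert h2 using 1
    funext n
    simp only [Pi.add_apply, sub_add_cancel]
    rfl
  refine ⟨⟨w, hmem⟩, fun n => rfl, ?_⟩
  have h1 : ‖schrodingerOp Ω v ⟨w, hmem⟩ - z • w‖ ≤ ‖G‖ := lp.norm_mono (by norm_num) hG
  have h2 : ‖G‖ ≤ R⁻¹ * (‖adjacencyCLM Ω‖ + 1) * ‖g‖ := by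
    rw [norm_smul, Complex.norm_real, Real.norm_of_nonneg (inv_pos.2 hR).le, mul_assoc]
    refine mul_le_mul_of_nonneg_left ?_ (inv_pos.2 hR).le
    refine (norm_add_le _ _).trans ?_
    rw [add_mul, one_mul]
    exact add_le_add_left ((adjacencyCLM Ω).le_opNorm g) _
  calc _ ≤ (R⁻¹ * (‖adjacencyCLM Ω‖ + 1) * ‖g‖) ^ 2 :=
        pow_le_pow_left₀ (norm_nonneg _) (h1.trans h2) 2
    _ = (R⁻¹ * (‖adjacencyCLM Ω‖ + 1)) ^ 2 * ‖g‖ ^ 2 := mul_pow _ _ _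
    _ ≤ _ := by gcongr

/-! ### The contradiction at a well-chosen scale -/

theorem upperDeriv_spectralMeasure_pos {d : ℕ} (Ω : Set (Fin d → ℤ)) (v : Ω → ℝ)
    (E : ℝ) (u : Ω → ℂ) (hu : schrodingerExpr Ω v u = (E : ℂ) • u)
    (α : ℝ) (hα1 : α ≤ 1)
    (hgrowth : liminf (fun R : ℝ => ENNReal.ofReal (R ^ (-α)) *
      ∑' n : {n : Ω // (n : Fin d → ℤ) ∈ cube d R}, ‖u n‖ₑ ^ 2) atTop < ⊤)
    (φ : ellTwo Ω) (hφ : (Function.support (φ : Ω → ℂ)).Finite)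
    (hne : ∑ n ∈ hφ.toFinset, u n * φ n ≠ 0) :
    0 < upperDeriv α (spectralMeasure (schrodingerOp Ω v) φ) E := by
  set μ := spectralMeasure (schrodingerOp Ω v) φ with hμdef
  have hμ : IsSpectralMeasure (schrodingerOp Ω v) φ μ := isSpectralMeasure_schrodingerOp Ω v φ
  have hfin : IsFiniteMeasure μ := hμ.1
  rw [pos_iff_ne_zero]
  intro h0
  obtain ⟨L', hL1, hL2⟩ := exists_between hgrowth
  lift L' to NNReal using hL2.ne
  have hfreq := frequently_lt_of_liminf_lt (by isBoundedDefault) hL1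
  set L : ℝ := (L' : ℝ)
  set c₀ := ∑ n ∈ hφ.toFinset, u n * φ n with hc₀
  set q : ℝ := (‖c₀‖ / 2) ^ 2
  have hq : 0 < q := by
    have := norm_pos_iff.2 hne
    positivity
  set K : ℝ := 16 * (‖adjacencyCLM Ω‖ + 1) ^ 2 * L with hK
  have hKpos : 0 ≤ K := by positivity
  -- This `η` gives `Kη ≤ q/4`; the `+ 1` keeps the denominator positive when `K = 0`.
  obtain ⟨c, hc, hdy⟩ := measure_dyadic_le_of_upperDeriv_eq_zero hα1 h0
    (η := q / (4 * (K + 1))) (by positivity)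
  have hpair : Tendsto (fun R => ∑ n ∈ hφ.toFinset, (cutoff R (n : Fin d → ℤ) : ℂ) * (u n * φ n))
      atTop (𝓝 c₀) := by
    refine tendsto_finsetSum _ fun n _ => ?_
    have := ((Complex.continuous_ofReal.tendsto 1).comp (tendsto_cutoff (n : Fin d → ℤ))).mul_const
      (u n * φ n)
    simpa using this
  have hev1 : ∀ᶠ R : ℝ in atTop,
      ‖c₀‖ / 2 < ‖∑ n ∈ hφ.toFinset, (cutoff R (n : Fin d → ℤ) : ℂ) * (u n * φ n)‖ :=
    hpair.norm.eventually_const_lt (half_lt_self (norm_pos_iff.2 hne))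
  have hev2 : ∀ᶠ R : ℝ in atTop, K * c * R ^ (α - 3 / 2) < q / 2 := by
    have h1 : Tendsto (fun R : ℝ => R ^ (-(3 / 2 - α))) atTop (𝓝 0) :=
      tendsto_rpow_neg_atTop (by linarith)
    have h2 := h1.const_mul (K * c)
    rw [mul_zero] at h2
    simp only [neg_sub] at h2
    exact h2.eventually_lt_const (by positivity)
  -- A single scale suffices, so a bound on the `liminf` is enough: the growth bound holds
  -- frequently, the other conditions eventually.
  obtain ⟨R, hR1, hR2, hR3, hR⟩ :=
    (hfreq.and_eventually (hev1.and (hev2.and (eventually_gt_atTop (0 : ℝ))))).exists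
  have hSR : ∑' n : {n : Ω // (n : Fin d → ℤ) ∈ cube d R}, ‖u n‖ₑ ^ 2
      ≤ ENNReal.ofReal (L * R ^ α) := by
    have h1 : ENNReal.ofReal (R ^ α) * ENNReal.ofReal (R ^ (-α)) = 1 := by
      rw [← ENNReal.ofReal_mul (by positivity), ← Real.rpow_add hR]
      simp
    have h2 := mul_le_mul_right hR1.le (ENNReal.ofReal (R ^ α))
    rw [← mul_assoc, h1, one_mul] at h2
    refine h2.trans (le_of_eq ?_)
    rw [ENNReal.ofReal_mul L'.coe_nonneg, mul_comm, ENNReal.ofReal_coe_nnreal]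
  obtain ⟨w, hw, hnorm⟩ := exists_cutoff_solution Ω v E u hu hR (by positivity) hSR
  have hε : 0 < R⁻¹ := inv_pos.2 hR
  have hint := lintegral_inv_sq_add_sq_le hε (hdy R⁻¹ hε)
  rw [← ENNReal.ofReal_mul (by positivity)] at hint
  have hmain := norm_inner_sq_le_of_isSpectralMeasure hμ w hε (by positivity) hint
  have hinner : inner ℂ (w : ellTwo Ω) φ
      = ∑ n ∈ hφ.toFinset, (cutoff R (n : Fin d → ℤ) : ℂ) * (u n * φ n) := by
    rw [lp.inner_eq_tsum, tsum_eq_sum (s := hφ.toFinset)]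
    · refine Finset.sum_congr rfl fun n _ => ?_
      rw [hw, RCLike.inner_apply]
      simp only [map_mul, Complex.conj_ofReal, Complex.conj_conj]
      ring
    · intro n hn
      have : φ n = 0 := by simpa using hn
      rw [this, inner_zero_right]
  rw [hinner] at hmain
  have h1 : q < ‖∑ n ∈ hφ.toFinset, (cutoff R (n : Fin d → ℤ) : ℂ) * (u n * φ n)‖ ^ 2 :=
    pow_lt_pow_left₀ hR2 (by positivity) two_ne_zero
  have h2 := mul_le_mul_of_nonneg_right hnorm (show 0 ≤ 16 * (R⁻¹ ^ 2)⁻¹ *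
    (q / (4 * (K + 1)) * R⁻¹ ^ α + c * R⁻¹ ^ (3 / 2 : ℝ)) by positivity)
  -- With `ε = R⁻¹`, the commutator's `R⁻²` cancels `ε⁻²` and the growth `R^α` cancels `ε^α`. The
  -- total is below `q/4 + q/2`, while the pairing squared exceeds `q`.
  have h3 : (R⁻¹ * (‖adjacencyCLM Ω‖ + 1)) ^ 2 * (L * R ^ α) * (16 * (R⁻¹ ^ 2)⁻¹ *
      (q / (4 * (K + 1)) * R⁻¹ ^ α + c * R⁻¹ ^ (3 / 2 : ℝ)))
      = K * (q / (4 * (K + 1))) + K * c * R ^ (α - 3 / 2) := by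
    rw [Real.inv_rpow hR.le, Real.inv_rpow hR.le, Real.rpow_sub hR, hK]
    have : 0 < R ^ α := by positivity
    have : 0 < R ^ (3 / 2 : ℝ) := by positivity
    field_simp
  have h4 : K * (q / (4 * (K + 1))) ≤ q / 4 := by
    rw [mul_div_assoc', div_le_div_iff₀ (by positivity) (by norm_num)]
    nlinarith
  rw [h3] at h2
  linarith

end

theorem theorem3p1 {d : ℕ} (Ω : Set (Fin d → ℤ)) (hinf : Ω.Infinite)
    (hconn : ((latticeGraph d).induce Ω).Connected) (v : Ω → ℝ)
    (E : ℝ) (u : Ω → ℂ) (hu : schrodingerExpr Ω v u = (E : ℂ) • u)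
    (α : ℝ) (hα0 : 0 ≤ α) (hα1 : α ≤ 1)
    (hgrowth : liminf (fun R : ℝ => ENNReal.ofReal (R ^ (-α)) *
      ∑' n : {n : Ω // (n : Fin d → ℤ) ∈ cube d R}, ‖u n‖ₑ ^ 2) atTop < ⊤) :
    (∀ (φ : ellTwo Ω) (hφ : (Function.support (φ : Ω → ℂ)).Finite),
      ∑ n ∈ hφ.toFinset, u n * φ n ≠ 0 →
        0 < upperDeriv α (spectralMeasure (schrodingerOp Ω v) φ) E) ∧
    (∀ n₀ : Ω, u n₀ ≠ 0 →
      0 < upperDeriv α (spectralMeasure (schrodingerOp Ω v) (lp.single 2 n₀ (1 : ℂ))) E) := by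
  have key := upperDeriv_spectralMeasure_pos Ω v E u hu α hα1 hgrowth
  refine ⟨key, fun n₀ hn₀ => ?_⟩
  have hsub : Function.support ((lp.single 2 n₀ (1 : ℂ) : ellTwo Ω) : Ω → ℂ) ⊆ {n₀} := by
    rw [lp.coeFn_single]
    exact Pi.support_single_subset
  have hfin := (Set.finite_singleton n₀).subset hsub
  refine key _ hfin ?_
  rw [Finset.sum_subset (s₂ := {n₀}) (by
    rw [← Finset.coe_subset, Set.Finite.coe_toFinset, Finset.coe_singleton]; exact hsub), Finset.sum_singleton,
    lp.single_apply_self, mul_one]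
  · exact hn₀
  · intro n _ hn
    have : (lp.single 2 n₀ (1 : ℂ) : ellTwo Ω) n = 0 := by simpa using hn
    rw [this, mul_zero]
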